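/- Let $p\ge 3$ be an integer and let $\Gamma_p\subset \mathrm{PSL}(2,\mathbb R)$ be the Hecke group, generated by $\iota: z\mapsto -1/z$ and $\alpha_p: z\mapsto z+2\cos(\pi/p)$; put $\gamma_p=\iota\alpha_p$. An element $g\in\Gamma_p$ is *reciprocal* if $hgh^{-1}=g^{-1}$ for some $h\in\Gamma_p$, and every such $h$ is called a *reciprocator* of $g$. The element $g$ is *hyperbolic* if its lifts $\begin{pmatrix}a&b\\c&d\end{pmatrix}\in\mathrm{SL}(2,\mathbb R)$ satisfy $|a+d|>2$, and *symmetric* if its lifts are symmetric matrices. The *fixed-point ratio* of a hyperbolic $g$ is $\theta_g=\frac{b-c}{a-d}$ if $a\ne d$, $\theta_g=\infty$ if $a=d$ and $b\neq c$, and $\theta_g=1$ if $a=d$ and $b=c$. A hyperbolic reciprocal element $g$ is *$p$-reciprocal* if $\theta_g\in\{\cos(\pi/p),1\}$, and *symmetric $p$-reciprocal* if $\theta_g=1$. Let $\mathcal C$ be the $\Gamma_p$-conjugacy class of a hyperbolic reciprocal element of $\Gamma_p$. Conjugacy below means conjugacy in $\Gamma_p$. 1. If $p$ is odd, then $\mathcal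 C$ contains exactly four symmetric elements. 2. If $p=2m$ is even, then every reciprocator of an element of $\mathcal C$ is conjugate to $\iota$ or to $\gamma_p^m$, and at least one of the hypotheses of (a), (b), (c) holds: (a) If all reciprocators of elements of $\mathcal C$ are conjugate to $\iota$, then $\mathcal C$ contains exactly four symmetric elements. (b) If all reciprocators of elements of $\mathcal C$ are conjugate to $\gamma_p^m$, then $\mathcal C$ contains exactly $2p$ $p$-reciprocal elements. (c) Suppose that each element of $\mathcal C$ has both a reciprocator conjugate to $\iota$ and a reciprocator conjugate to $\gamma_p^m$. (i) If $\mathcal C$ contains no power $(\iota\gamma_p^m)^k$ with $k\in\mathbb Z\setminus\{0\}$, then $\mathcal C$ contains exactly two symmetric elements and exactly $p$ $p$-reciprocal elements, and no element of $\mathcal C$ is both symmetric and $p$-reciprocal. (ii) If $\mathcal C$ contains a power $(\iota\gamma_p^m)^k$ with $k\in\mathbb Z\setminus\{0\}$, then $\mathcal C$ contains exactly two symmetric $p$-reciprocal elements, every symmetric element of $\mathcal C$ is one of these two, and $\mathcal C$ contains exactly $p-2$ further $p$-reciprocal elements (those with $\theta_g\ne 1$). -/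

import Mathlib

open scoped MatrixGroups

noncomputable section

namespace Hecke

/-- The group PSL(2, ℝ) = SL(2, ℝ) / {±1}. -/
abbrev PSL2R : Type := Matrix.ProjectiveSpecialLinearGroup (Fin 2) ℝ

/-- The class in PSL(2, ℝ) of a matrix of SL(2, ℝ); `M` is a lift of `toPSL M`. -/
abbrev toPSL : SL(2, ℝ) →* PSL2R :=
  QuotientGroup.mk' (Subgroup.center SL(2, ℝ))

/-- `λ_p = 2 cos (π / p)`. -/
def lam (p : ℕ) : ℝ := 2 * Real.cos (Real.pi / p)

/-- The matrix of `z ↦ -1 / z`. -/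
def matS : SL(2, ℝ) := ⟨!![0, -1; 1, 0], by simp [Matrix.det_fin_two]⟩

/-- The matrix of `z ↦ z + 2 cos (π / p)`. -/
def matT (p : ℕ) : SL(2, ℝ) := ⟨!![1, lam p; 0, 1], by simp [Matrix.det_fin_two]⟩

/-- The Hecke group `Γ_p`, the subgroup of PSL(2, ℝ) generated by `z ↦ -1 / z` and
`z ↦ z + 2 cos (π / p)`. -/
def heckeGroup (p : ℕ) : Subgroup PSL2R :=
  Subgroup.closure {toPSL matS, toPSL (matT p)}

/-- `ι : z ↦ -1 / z` as an element of `Γ_p`. -/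
def iota (p : ℕ) : heckeGroup p :=
  ⟨toPSL matS, Subgroup.subset_closure (by simp)⟩

/-- `α_p : z ↦ z + 2 cos (π / p)` as an element of `Γ_p`. -/
def alpha (p : ℕ) : heckeGroup p :=
  ⟨toPSL (matT p), Subgroup.subset_closure (by simp)⟩

/-- `γ_p = ι α_p : z ↦ -1 / (z + 2 cos (π / p))`. -/
def gam (p : ℕ) : heckeGroup p := iota p * alpha p

/-- `h` is a reciprocator of `g`. -/
def IsReciprocator {G : Type*} [Group G] (h g : G) : Prop := h * g * h⁻¹ = g⁻¹

/-- `g` is reciprocal in `G`. -/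
def IsReciprocal {G : Type*} [Group G] (g : G) : Prop := ∃ h : G, IsReciprocator h g

/-- An element of PSL(2, ℝ) is hyperbolic if it has a hyperbolic lift; Mathlib's condition on the
lift is `0 < tr² - 4 det`, that is, `|tr| > 2`. -/
def IsHyperbolic (g : PSL2R) : Prop :=
  ∃ M : SL(2, ℝ), toPSL M = g ∧ (M : Matrix (Fin 2) (Fin 2) ℝ).IsHyperbolic

/-- An element of PSL(2, ℝ) is symmetric if it has a symmetric lift. -/
def IsSymmetric (g : PSL2R) : Prop :=
  ∃ M : SL(2, ℝ), toPSL M = g ∧ (M : Matrix (Fin 2) (Fin 2) ℝ).IsSymm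

open scoped Classical in
/-- The fixed-point ratio of the matrix `[a, b; c, d]`, with values in `ℝ ∪ {∞}`:
`(b - c) / (a - d)` if `a ≠ d`, `1` if `a = d` and `b = c`, `∞` if `a = d` and `b ≠ c`. -/
def matRatio (M : SL(2, ℝ)) : OnePoint ℝ :=
  if M 0 0 ≠ M 1 1 then (((M 0 1 - M 1 0) / (M 0 0 - M 1 1) : ℝ) : OnePoint ℝ)
  else if M 0 1 = M 1 0 then ((1 : ℝ) : OnePoint ℝ)
  else OnePoint.infty

theorem matRatio_mul_center (M Z : SL(2, ℝ)) (hZ : Z ∈ Subgroup.center SL(2, ℝ)) :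
    matRatio (M * Z) = matRatio M := by
  obtain ⟨s, hs, hsZ⟩ := Matrix.SpecialLinearGroup.mem_center_iff.mp hZ
  have hs0 : s ≠ 0 := by
    rintro rfl
    simp at hs
  have key : ∀ i j, (M * Z) i j = M i j * s := by
    intro i j
    rw [Matrix.SpecialLinearGroup.coe_mul, ← hsZ]
    simp [Matrix.scalar_apply, Matrix.mul_diagonal]
  simp only [matRatio, key, ← sub_mul, mul_div_mul_right _ _ hs0, ne_eq, mul_eq_mul_right_iff,
    hs0, or_false]

/-- The fixed-point ratio `θ_g` of an element of PSL(2, ℝ), computed on any lift. (It is only used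
for hyperbolic `g`.) -/
def ratio (g : PSL2R) : OnePoint ℝ :=
  Quotient.liftOn' g matRatio (by
    intro M N h
    rw [QuotientGroup.leftRel_apply] at h
    have := matRatio_mul_center M (M⁻¹ * N) h
    rw [mul_inv_cancel_left] at this
    exact this.symm)

/-- A hyperbolic reciprocal element of `Γ_p` is `p`-reciprocal if its fixed-point ratio is
`cos (π / p)` or `1`. -/
def IsPReciprocal (p : ℕ) (g : heckeGroup p) : Prop :=
  IsHyperbolic g ∧ IsReciprocal g ∧
    (ratio g = ((Real.cos (Real.pi / p) : ℝ) : OnePoint ℝ) ∨ ratio g = ((1 : ℝ) : OnePoint ℝ))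

/-- A hyperbolic reciprocal element of `Γ_p` is symmetric `p`-reciprocal if its fixed-point ratio
is `1`. -/
def IsSymmetricPReciprocal (p : ℕ) (g : heckeGroup p) : Prop :=
  IsHyperbolic g ∧ IsReciprocal g ∧ ratio g = ((1 : ℝ) : OnePoint ℝ)

/-- The class of `r` in `G` is of pure type `s`: all reciprocators of elements of the class are
conjugate to `s` in `G`. -/
def PureType {G : Type*} [Group G] (r s : G) : Prop :=
  ∀ g ∈ conjugatesOf r, ∀ h : G, IsReciprocator h g → IsConj h s

/-- The class of `r` in `G` is of mixed type `s`, `t`: each element of the class has a reciprocator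
conjugate to `s` in `G` and a reciprocator conjugate to `t` in `G`. -/
def MixedType {G : Type*} [Group G] (r s t : G) : Prop :=
  ∀ g ∈ conjugatesOf r,
    (∃ h : G, IsReciprocator h g ∧ IsConj h s) ∧ (∃ h : G, IsReciprocator h g ∧ IsConj h t)

end Hecke

end

/-!
`Γ_p` acts on the pairs `(g, h)` with `g` in the class `C` of `r` and `h` a reciprocator of `g`.
A reciprocator of a hyperbolic element has trace zero, so it is an involution, and the centralizer
of `r` is infinite cyclic, say generated by `t`. The reciprocators of `r` are then the `h₀ t ^ k`,
and conjugation by `t` changes `k` by `2`, so there are exactly two orbits of such pairs, namely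
those of `(r, h₀)` and `(r, h₀ t)`. For an involution `s`, the pairs in a given orbit with second
entry `s` are permuted simply transitively by the centralizer of `s`, if there are any. This gives
`2 |Z(s)|` elements of `C` with reciprocator `s` if all reciprocators are conjugate to `s`, and
`|Z(s)|` elements if only one of the orbits has this type (`DihedralData.encard_of_pureType`,
`DihedralData.encard_of_mixedType`). It remains to use that `Z(ι)` has order `2` and
`Z(γ_p ^ m)`, for `p = 2 m`, order `p`; that a hyperbolic element is symmetric exactly if `ι` is one
of its reciprocators; and that a hyperbolic reciprocal element is `p`-reciprocal exactly if
`γ_p ^ m` is one.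

All facts about `Γ_p` come from one observation: every element is a product of the elements
`ι γ_p ^ k`, `0 < k < p`, up to factors `ι` at the ends (`isNormalForm`), and these elements have
lifts with nonnegative entries and with diagonal entries at least `1` (`isPositive_uMat`). Positivity
of the words gives:

* involutions are conjugate to `ι` or `γ_p ^ m`, as nonempty words have trace at least `2`
  (`isConj_of_lift_trace`);
* the centralizers of `ι` and `γ_p ^ m` are the obvious ones (`exists_eq_iota_pow_of_commute`,
  `exists_eq_gam_pow_of_commute`);
* `Γ_p` is discrete, as the entries of a word bound its length (`finite_bounded`). Hence the
  centralizer of a hyperbolic element is infinite cyclic (`exists_dihedralData`), and for even `p` an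
  element fixing `-1` also fixes `1` (`diag_eq_of_fixes_neg_one`), so that `θ_g = 1` forces `a = d`
  and `b = c`;
* an element fixing both `1` and `-1` is a power of `ι γ_p ^ m` (`exists_eq_zpow_of_commute`).

That the words are unique, that is, that `Γ_p` is the free product of `⟨ι⟩` and `⟨γ_p⟩`, is never
needed.
-/

noncomputable section

namespace Hecke

/-! ### Words in a group generated by an involution and an element of finite order -/

section Words

variable {G : Type*} [Group G]

/-- The product `∏ s c ^ k` over the letters `k` of `l`. -/
def word (s c : G) (l : List ℕ) : G := (l.map fun k => s * c ^ k).prod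

/-- The letters `k` of `l` all satisfy `0 < k < p`. -/
def Letters (p : ℕ) (l : List ℕ) : Prop := ∀ k ∈ l, 0 < k ∧ k < p

@[simp] theorem word_nil (s c : G) : word s c [] = 1 := rfl

@[simp] theorem word_cons (s c : G) (k : ℕ) (l : List ℕ) :
    word s c (k :: l) = s * c ^ k * word s c l := by simp [word]

theorem word_append (s c : G) (l l' : List ℕ) :
    word s c (l ++ l') = word s c l * word s c l' := by simp [word]

theorem letters_nil (p : ℕ) : Letters p [] := by simp [Letters]

theorem letters_cons {p k : ℕ} {l : List ℕ} :
    Letters p (k :: l) ↔ (0 < k ∧ k < p) ∧ Letters p l := by simp [Letters]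

theorem letters_append {p : ℕ} {l l' : List ℕ} :
    Letters p (l ++ l') ↔ Letters p l ∧ Letters p l' := by
  simp only [Letters, List.mem_append]
  exact ⟨fun h => ⟨fun k hk => h k (.inl hk), fun k hk => h k (.inr hk)⟩,
    fun h k hk => hk.elim (h.1 k) (h.2 k)⟩

variable {s c : G} {p : ℕ}

/-- `x` is a word in the elements `s c ^ k`, `0 < k < p`, up to factors `s` at both ends. -/
def IsNormalForm (s c : G) (p : ℕ) (x : G) : Prop :=
  ∃ l, Letters p l ∧ ∃ a b : ℕ, a < 2 ∧ b < 2 ∧ x = s ^ a * word s c l * s ^ b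

theorem IsNormalForm.mul_involution_left (hs : s * s = 1) {x : G} (hx : IsNormalForm s c p x) :
    IsNormalForm s c p (s * x) := by
  obtain ⟨l, hl, a, b, ha, hb, rfl⟩ := hx
  interval_cases a
  · exact ⟨l, hl, 1, b, by simp, hb, by simp [mul_assoc]⟩
  · exact ⟨l, hl, 0, b, by simp, hb, by simp [← mul_assoc, hs]⟩

theorem IsNormalForm.mul_rotation_left (hs : s * s = 1) (hc : c ^ p = 1) (hp : 2 ≤ p) {x : G}
    (hx : IsNormalForm s c p x) : IsNormalForm s c p (c * x) := by
  obtain ⟨l, hl, a, b, ha, hb, rfl⟩ := hx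
  interval_cases a
  · refine ⟨1 :: l, letters_cons.2 ⟨⟨one_pos, by omega⟩, hl⟩, 1, b, by simp, hb, ?_⟩
    simp [← mul_assoc, hs]
  · cases l with
    | nil =>
      refine ⟨[1], letters_cons.2 ⟨⟨one_pos, by omega⟩, hl⟩, 1, (1 + b) % 2, by simp,
        Nat.mod_lt _ two_pos, ?_⟩
      interval_cases b <;> simp [← mul_assoc, hs]
    | cons k l =>
      have hl' := letters_cons.1 hl
      by_cases hk : k + 1 < p
      · refine ⟨(k + 1) :: l, letters_cons.2 ⟨⟨by omega, hk⟩, hl'.2⟩, 1, b, by simp, hb, ?_⟩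
        have : c * (s * (s * c ^ k)) = s * (s * c ^ (k + 1)) := by
          simp [← mul_assoc, hs, pow_succ']
        simp only [word_cons, pow_one, ← mul_assoc] at this ⊢
        rw [this]
      · refine ⟨l, hl'.2, 0, b, by simp, hb, ?_⟩
        have hkp : k + 1 = p := by omega
        have : c * (s * (s * c ^ k)) = 1 := by
          rw [← mul_assoc s, hs, one_mul, ← pow_succ', hkp, hc]
        simp only [word_cons, pow_one, ← mul_assoc, pow_zero, one_mul] at this ⊢
        rw [this, one_mul]

theorem isNormalForm_of_mem_closure (hs : s * s = 1) (hc : c ^ p = 1) (hp : 2 ≤ p) {x : G}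
    (hx : x ∈ Subgroup.closure {s, c}) : IsNormalForm s c p x := by
  have hpow : ∀ n : ℕ, ∀ y, IsNormalForm s c p y → IsNormalForm s c p (c ^ n * y) := by
    intro n
    induction n with
    | zero => intro y hy; simpa using hy
    | succ n ih =>
      intro y hy
      rw [pow_succ', mul_assoc]
      exact (ih y hy).mul_rotation_left hs hc hp
  have hcinv : c⁻¹ = c ^ (p - 1) := by
    rw [inv_eq_iff_mul_eq_one, ← pow_succ', Nat.sub_add_cancel (by omega), hc]
  have hsinv : s⁻¹ = s := by rw [inv_eq_iff_mul_eq_one, hs]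
  induction hx using Subgroup.closure_induction_left with
  | one => exact ⟨[], letters_nil p, 0, 0, by simp, by simp, by simp⟩
  | mul_left x hx y _ ih =>
    rcases hx with rfl | rfl
    · exact ih.mul_involution_left hs
    · exact ih.mul_rotation_left hs hc hp
  | inv_mul_cancel x hx y _ ih =>
    rcases hx with rfl | rfl
    · rw [hsinv]; exact ih.mul_involution_left hs
    · rw [hcinv]; exact hpow _ _ ih

/-- The conjugacy classes met by `s`, by the powers of `c` and by the nonempty words. -/
def IsConjStandard (s c : G) (p : ℕ) (x : G) : Prop :=
  IsConj x s ∨ (∃ k : ℕ, IsConj x (c ^ k)) ∨ ∃ l, Letters p l ∧ l ≠ [] ∧ IsConj x (word s c l)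

theorem IsConjStandard.of_isConj {x y : G} (h : IsConj x y) (hy : IsConjStandard s c p y) :
    IsConjStandard s c p x := by
  rcases hy with hy | ⟨k, hy⟩ | ⟨l, hl, hne, hy⟩
  · exact .inl (h.trans hy)
  · exact .inr (.inl ⟨k, h.trans hy⟩)
  · exact .inr (.inr ⟨l, hl, hne, h.trans hy⟩)

theorem isConj_mul_comm (x y : G) : IsConj (x * y) (y * x) :=
  isConj_iff.2 ⟨x⁻¹, by group⟩

theorem isConjStandard_word (p : ℕ) {l : List ℕ} (hl : Letters p l) :
    IsConjStandard s c p (word s c l) := by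
  by_cases h : l = []
  · subst h
    exact .inr (.inl ⟨0, by simp⟩)
  · exact .inr (.inr ⟨l, hl, h, IsConj.refl _⟩)

/-- Cyclic reduction: the last and the first letter of a word followed by `s` merge, so that the
word gets shorter. -/
theorem isConjStandard_word_mul (hs : s * s = 1) (hc : c ^ p = 1) (n : ℕ) :
    ∀ l : List ℕ, l.length = n → Letters p l → IsConjStandard s c p (word s c l * s) := by
  induction n using Nat.strong_induction_on with
  | _ n ih =>
  intro l hn hl
  cases l with
  | nil => exact .inl (by rw [word_nil, one_mul])
  | cons k l =>
  obtain ⟨⟨hk0, hkp⟩, hl'⟩ := letters_cons.1 hl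
  rcases List.eq_nil_or_concat l with rfl | ⟨l, j, rfl⟩
  · refine .inr (.inl ⟨k, ?_⟩)
    have := isConj_mul_comm (s * c ^ k) s
    simpa [← mul_assoc, hs] using this
  · obtain ⟨hl, hj⟩ := letters_append.1 (by simpa using hl')
    obtain ⟨⟨hj0, hjp⟩, -⟩ := letters_cons.1 hj
    have hconj : IsConj (word s c (k :: l.concat j) * s) (s * c ^ (j + k) * word s c l) := by
      have := isConj_mul_comm (s * c ^ k * word s c l) (s * c ^ j * s)
      have e : s * c ^ j * s * (s * c ^ k * word s c l) = s * c ^ (j + k) * word s c l := by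
        rw [pow_add]
        simp only [← mul_assoc]
        rw [mul_assoc (s * c ^ j) s s, hs, mul_one]
      rw [e] at this
      simpa [word_append, mul_assoc] using this
    refine .of_isConj hconj ?_
    rcases lt_trichotomy (j + k) p with h | h | h
    · rw [← word_cons]
      exact isConjStandard_word p (letters_cons.2 ⟨⟨by omega, h⟩, hl⟩)
    · rw [h, hc, mul_one]
      refine .of_isConj (isConj_mul_comm _ _) (ih l.length ?_ l rfl hl)
      simp at hn; omega
    · have : c ^ (j + k) = c ^ (j + k - p) := by
        conv_lhs => rw [← Nat.sub_add_cancel h.le, pow_add, hc, mul_one]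
      rw [this, ← word_cons]
      exact isConjStandard_word p (letters_cons.2 ⟨⟨by omega, by omega⟩, hl⟩)

theorem IsNormalForm.isConjStandard (hs : s * s = 1) (hc : c ^ p = 1) {x : G}
    (hx : IsNormalForm s c p x) : IsConjStandard s c p x := by
  obtain ⟨l, hl, a, b, ha, hb, rfl⟩ := hx
  refine .of_isConj (isConj_mul_comm _ _) ?_
  rw [← mul_assoc, ← pow_add]
  refine .of_isConj (isConj_mul_comm _ _) ?_
  have h2 : s ^ 2 = 1 := by rw [pow_two, hs]
  interval_cases a <;> interval_cases b <;>
    simp only [add_zero, zero_add, pow_zero, pow_one, mul_one, Nat.reduceAdd, h2]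
  · exact isConjStandard_word p hl
  · exact isConjStandard_word_mul hs hc _ l rfl hl
  · exact isConjStandard_word_mul hs hc _ l rfl hl
  · exact isConjStandard_word p hl

end Words

/-! ### Counting the conjugates with a given reciprocator -/

section Count

variable {G : Type*} [Group G]

theorem IsReciprocator.conj {h g : G} (hg : IsReciprocator h g) (x : G) :
    IsReciprocator (x * h * x⁻¹) (x * g * x⁻¹) := by
  unfold IsReciprocator at *
  calc _ = x * (h * g * h⁻¹) * x⁻¹ := by group
    _ = _ := by rw [hg]; group

theorem IsReciprocator.of_conj {h g x : G} (hg : IsReciprocator (x * h * x⁻¹) (x * g * x⁻¹)) :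
    IsReciprocator h g := by
  have := hg.conj x⁻¹
  simpa [mul_assoc] using this

/-- The conjugates of `r` obtained by conjugating the pair `(r, h)` to a pair `(g, s)`. -/
def slice (r h s : G) : Set G := {g | ∃ x, x * r * x⁻¹ = g ∧ x * h * x⁻¹ = s}

/-- The centralizer of `s` acts simply transitively on a nonempty slice, if it meets the
centralizers of the conjugates of `r` trivially. -/
theorem encard_slice {r h s : G} (hconj : IsConj h s)
    (htriv : ∀ g ∈ conjugatesOf r, ∀ z, Commute z s → Commute z g → z = 1) :
    (slice r h s).encard = ENat.card (Subgroup.centralizer {s}) := by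
  obtain ⟨x₀, hx₀⟩ := isConj_iff.1 hconj
  set g₀ := x₀ * r * x₀⁻¹ with hg₀
  let f : Subgroup.centralizer {s} → G := fun z => z * g₀ * (z : G)⁻¹
  have hf : Function.Injective f := by
    rintro ⟨z, hz⟩ ⟨w, hw⟩ hzw
    simp only [f] at hzw
    rw [Subgroup.mem_centralizer_singleton_iff] at hz hw
    have hz' : Commute z s := hz
    have hw' : Commute w s := hw
    have : w⁻¹ * z = 1 := by
      refine htriv g₀ (isConj_iff.2 ⟨x₀, rfl⟩) _ (hw'.inv_left.mul_left hz') ?_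
      show w⁻¹ * z * g₀ = g₀ * (w⁻¹ * z)
      calc w⁻¹ * z * g₀ = w⁻¹ * (z * g₀ * z⁻¹) * z := by group
        _ = _ := by rw [hzw]; group
    rw [inv_mul_eq_one] at this
    exact Subtype.ext this.symm
  have hr : slice r h s = Set.range f := by
    ext g
    constructor
    · rintro ⟨x, rfl, hx⟩
      refine ⟨⟨x * x₀⁻¹, ?_⟩, ?_⟩
      · rw [Subgroup.mem_centralizer_singleton_iff]
        calc x * x₀⁻¹ * s = x * x₀⁻¹ * (x₀ * h * x₀⁻¹) := by rw [hx₀]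
          _ = (x * h * x⁻¹) * (x * x₀⁻¹) := by group
          _ = _ := by rw [hx]
      · simp only [f, hg₀]; group
    · rintro ⟨⟨z, hz⟩, rfl⟩
      rw [Subgroup.mem_centralizer_singleton_iff] at hz
      refine ⟨z * x₀, by simp only [f, hg₀]; group, ?_⟩
      calc z * x₀ * h * (z * x₀)⁻¹ = z * (x₀ * h * x₀⁻¹) * z⁻¹ := by group
        _ = s := by rw [hx₀, hz]; group
  rw [hr, ← Set.image_univ, hf.encard_image, Set.encard_univ]

theorem slice_eq_empty {r h s : G} (h' : ¬ IsConj h s) : slice r h s = ∅ := by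
  ext g
  simp only [slice, Set.mem_ofPred_eq, Set.mem_empty_iff_false, iff_false]
  rintro ⟨x, -, hx⟩
  exact h' (isConj_iff.2 ⟨x, hx⟩)

/-- The data behind the count: the centralizer of `r` is infinite cyclic, generated by `t`, and
`h` is a reciprocator of `r`; all reciprocators of `r` are involutions. -/
structure DihedralData (r t h : G) : Prop where
  involution : ∀ k, IsReciprocator k r → k * k = 1
  comm : Commute t r
  cyclic : ∀ z, Commute z r → ∃ k : ℤ, z = t ^ k
  infinite : ∀ k : ℤ, t ^ k = 1 → k = 0
  recip : IsReciprocator h r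

namespace DihedralData

variable {r t h : G}

theorem recip_mul (D : DihedralData r t h) (k : ℤ) : IsReciprocator (h * t ^ k) r := by
  have h1 : Commute (t ^ k) r := D.comm.zpow_left k
  have h2 := D.recip
  unfold IsReciprocator at *
  calc h * t ^ k * r * (h * t ^ k)⁻¹ = h * (t ^ k * r) * (t ^ k)⁻¹ * h⁻¹ := by group
    _ = h * r * h⁻¹ := by rw [h1.eq]; group
    _ = _ := h2

theorem exists_eq_mul (D : DihedralData r t h) {k : G} (hk : IsReciprocator k r) :
    ∃ j : ℤ, k = h * t ^ j := by
  have h2 := D.recip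
  obtain ⟨j, hj⟩ := D.cyclic (h⁻¹ * k) (by
    unfold IsReciprocator at *
    show h⁻¹ * k * r = r * (h⁻¹ * k)
    have e1 : k * r = r⁻¹ * k := by rw [← hk]; group
    have e2 : h⁻¹ * r⁻¹ = r * h⁻¹ := by rw [← h2]; group
    rw [mul_assoc, e1, ← mul_assoc, e2, mul_assoc])
  exact ⟨j, by rw [← hj]; group⟩

theorem swap (D : DihedralData r t h) (j : ℤ) : t ^ j * h = h * t ^ (-j) := by
  have h1 := D.involution _ (D.recip_mul j)
  have h2 := D.involution _ D.recip
  have h3 : h⁻¹ = h := inv_eq_of_mul_eq_one_left h2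
  have : t ^ j * h * t ^ j = h := by
    calc t ^ j * h * t ^ j = h⁻¹ * (h * t ^ j * (h * t ^ j)) := by group
      _ = h := by rw [h1, mul_one, h3]
  rw [zpow_neg, eq_mul_inv_iff_mul_eq, this]

theorem conj_eq (D : DihedralData r t h) (i j : ℤ) :
    t ^ j * (h * t ^ i) * (t ^ j)⁻¹ = h * t ^ (i - 2 * j) := by
  rw [← mul_assoc, D.swap, mul_assoc, mul_assoc, ← zpow_neg, ← zpow_add, ← zpow_add]
  congr 2; ring

/-- Reciprocators of `r` form two orbits under the centralizer of `r`. -/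
theorem orbit (D : DihedralData r t h) {k : G} (hk : IsReciprocator k r) :
    ∃ j : ℤ, k = t ^ j * h * (t ^ j)⁻¹ ∨ k = t ^ j * (h * t) * (t ^ j)⁻¹ := by
  obtain ⟨i, rfl⟩ := D.exists_eq_mul hk
  have h0 := D.conj_eq 0
  have h1 := D.conj_eq 1
  simp only [zpow_zero, mul_one, zpow_one] at h0 h1
  rcases Int.even_or_odd' i with ⟨q, rfl | rfl⟩
  · exact ⟨-q, .inl (by rw [h0]; congr 2; ring)⟩
  · exact ⟨-q, .inr (by rw [h1]; congr 2; ring)⟩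

theorem not_same_orbit (D : DihedralData r t h) {z : G} (hz : Commute z r) :
    z * h * z⁻¹ ≠ h * t := by
  obtain ⟨j, rfl⟩ := D.cyclic z hz
  have h0 := D.conj_eq 0 j
  simp only [zpow_zero, mul_one] at h0
  rw [h0, ne_eq, mul_right_inj]
  intro e
  have := D.infinite (0 - 2 * j - 1) (by rw [zpow_sub, e]; simp)
  omega

theorem setOf_recip_eq (D : DihedralData r t h) (s : G) :
    {g ∈ conjugatesOf r | IsReciprocator s g} = slice r h s ∪ slice r (h * t) s := by
  have h1 := D.recip_mul 1
  rw [zpow_one] at h1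
  ext g
  constructor
  · rintro ⟨hg, hs⟩
    obtain ⟨x, rfl⟩ := isConj_iff.1 hg
    have hs' : IsReciprocator (x⁻¹ * s * x) r := by
      apply IsReciprocator.of_conj (x := x)
      convert hs using 1; group
    have hcom : ∀ j : ℤ, t ^ j * r * (t ^ j)⁻¹ = r := fun j => by
      rw [(D.comm.zpow_left j).eq]; group
    obtain ⟨j, hj | hj⟩ := D.orbit hs'
    · refine .inl ⟨x * t ^ j, ?_, ?_⟩
      · calc _ = x * (t ^ j * r * (t ^ j)⁻¹) * x⁻¹ := by group
          _ = _ := by rw [hcom]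
      · calc _ = x * (t ^ j * h * (t ^ j)⁻¹) * x⁻¹ := by group
          _ = _ := by rw [← hj]; group
    · refine .inr ⟨x * t ^ j, ?_, ?_⟩
      · calc _ = x * (t ^ j * r * (t ^ j)⁻¹) * x⁻¹ := by group
          _ = _ := by rw [hcom]
      · calc _ = x * (t ^ j * (h * t) * (t ^ j)⁻¹) * x⁻¹ := by group
          _ = _ := by rw [← hj]; group
  · rintro (⟨x, rfl, rfl⟩ | ⟨x, rfl, rfl⟩)
    · exact ⟨isConj_iff.2 ⟨x, rfl⟩, D.recip.conj x⟩
    · exact ⟨isConj_iff.2 ⟨x, rfl⟩, h1.conj x⟩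

theorem disjoint_slice (D : DihedralData r t h) (s : G) :
    Disjoint (slice r h s) (slice r (h * t) s) := by
  rw [Set.disjoint_left]
  rintro g ⟨x, hx, hxs⟩ ⟨y, hy, hys⟩
  refine D.not_same_orbit (z := y⁻¹ * x) ?_ ?_
  · show y⁻¹ * x * r = r * (y⁻¹ * x)
    calc y⁻¹ * x * r = y⁻¹ * (x * r * x⁻¹) * x := by group
      _ = _ := by rw [hx, ← hy]; group
  · calc y⁻¹ * x * h * (y⁻¹ * x)⁻¹ = y⁻¹ * (x * h * x⁻¹) * y := by group
      _ = _ := by rw [hxs, ← hys]; group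

theorem encard_eq_add (D : DihedralData r t h) (s : G) :
    {g ∈ conjugatesOf r | IsReciprocator s g}.encard =
      (slice r h s).encard + (slice r (h * t) s).encard := by
  rw [D.setOf_recip_eq, Set.encard_union_eq (D.disjoint_slice s)]

theorem encard_of_pureType (D : DihedralData r t h) {s : G} (hp : PureType r s)
    (htriv : ∀ g ∈ conjugatesOf r, ∀ z, Commute z s → Commute z g → z = 1) :
    {g ∈ conjugatesOf r | IsReciprocator s g}.encard =
      2 * ENat.card (Subgroup.centralizer {s}) := by
  have h1 := D.recip_mul 1
  rw [zpow_one] at h1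
  rw [D.encard_eq_add, encard_slice (hp r (IsConj.refl r) _ D.recip) htriv,
    encard_slice (hp r (IsConj.refl r) _ h1) htriv, two_mul]

theorem isConj_or (D : DihedralData r t h) {s : G}
    (hm : ∃ k, IsReciprocator k r ∧ IsConj k s) : IsConj h s ∨ IsConj (h * t) s := by
  obtain ⟨k, hk, hks⟩ := hm
  obtain ⟨j, rfl | rfl⟩ := D.orbit hk
  · exact .inl ((isConj_iff.2 ⟨_, rfl⟩ : IsConj h _).trans hks)
  · exact .inr ((isConj_iff.2 ⟨_, rfl⟩ : IsConj (h * t) _).trans hks)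

theorem encard_of_mixedType (D : DihedralData r t h) {s s' : G} (hss : ¬ IsConj s s')
    (hm : ∃ k, IsReciprocator k r ∧ IsConj k s) (hm' : ∃ k, IsReciprocator k r ∧ IsConj k s')
    (htriv : ∀ g ∈ conjugatesOf r, ∀ z, Commute z s → Commute z g → z = 1) :
    {g ∈ conjugatesOf r | IsReciprocator s g}.encard =
      ENat.card (Subgroup.centralizer {s}) := by
  rw [D.encard_eq_add]
  rcases D.isConj_or hm with h1 | h1 <;> rcases D.isConj_or hm' with h2 | h2
  · exact absurd (h1.symm.trans h2) hss
  · rw [encard_slice h1 htriv, slice_eq_empty fun h3 => hss (h3.symm.trans h2)]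
    simp
  · rw [encard_slice h1 htriv, slice_eq_empty fun h3 => hss (h3.symm.trans h2)]
    simp
  · exact absurd (h1.symm.trans h2) hss

end DihedralData

end Count

/-! ### Lifts to `SL(2, ℝ)` -/

theorem mul_apply_two (M N : SL(2, ℝ)) (i j : Fin 2) :
    (M * N) i j = M i 0 * N 0 j + M i 1 * N 1 j := by
  simp [Matrix.SpecialLinearGroup.coe_mul, Matrix.mul_apply, Fin.sum_univ_two]

theorem det_two (M : SL(2, ℝ)) : M 0 0 * M 1 1 - M 0 1 * M 1 0 = 1 := by
  have := M.det_coe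
  rwa [Matrix.det_fin_two] at this

theorem neg_apply_two (M : SL(2, ℝ)) (i j : Fin 2) : (-M) i j = -M i j := by
  simp [Matrix.SpecialLinearGroup.coe_neg]

theorem ext_two {M N : SL(2, ℝ)} (h00 : M 0 0 = N 0 0) (h01 : M 0 1 = N 0 1)
    (h10 : M 1 0 = N 1 0) (h11 : M 1 1 = N 1 1) : M = N := by
  ext i j
  fin_cases i <;> fin_cases j <;> assumption

@[simp] theorem inv_apply_00 (M : SL(2, ℝ)) : M⁻¹ 0 0 = M 1 1 := by
  simp [Matrix.SpecialLinearGroup.SL2_inv_expl]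
@[simp] theorem inv_apply_01 (M : SL(2, ℝ)) : M⁻¹ 0 1 = -M 0 1 := by
  simp [Matrix.SpecialLinearGroup.SL2_inv_expl]
@[simp] theorem inv_apply_10 (M : SL(2, ℝ)) : M⁻¹ 1 0 = -M 1 0 := by
  simp [Matrix.SpecialLinearGroup.SL2_inv_expl]
@[simp] theorem inv_apply_11 (M : SL(2, ℝ)) : M⁻¹ 1 1 = M 0 0 := by
  simp [Matrix.SpecialLinearGroup.SL2_inv_expl]
@[simp] theorem one_apply_00 : (1 : SL(2, ℝ)) 0 0 = 1 := by simp
@[simp] theorem matS_00 : matS 0 0 = 0 := rfl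
@[simp] theorem matS_01 : matS 0 1 = -1 := rfl
@[simp] theorem matS_10 : matS 1 0 = 1 := rfl
@[simp] theorem matS_11 : matS 1 1 = 0 := rfl
@[simp] theorem matT_00 (p : ℕ) : matT p 0 0 = 1 := rfl
@[simp] theorem matT_01 (p : ℕ) : matT p 0 1 = lam p := rfl
@[simp] theorem matT_10 (p : ℕ) : matT p 1 0 = 0 := rfl
@[simp] theorem matT_11 (p : ℕ) : matT p 1 1 = 1 := rfl

theorem toPSL_eq_iff {M N : SL(2, ℝ)} : toPSL M = toPSL N ↔ N = M ∨ N = -M := by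
  rw [QuotientGroup.mk'_eq_mk']
  constructor
  · rintro ⟨Z, hZ, rfl⟩
    obtain ⟨s, hs, hsZ⟩ := Matrix.SpecialLinearGroup.mem_center_iff.mp hZ
    have hs' : s = 1 ∨ s = -1 := by simpa using hs
    have key : ∀ i j, (M * Z) i j = M i j * s := by
      intro i j
      rw [Matrix.SpecialLinearGroup.coe_mul, ← hsZ]
      simp [Matrix.scalar_apply, Matrix.mul_diagonal]
    rcases hs' with rfl | rfl
    · left; ext i j; simp [key]
    · right; ext i j; rw [key, neg_apply_two]; ring
  · rintro (rfl | rfl)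
    · exact ⟨1, one_mem _, by simp⟩
    · refine ⟨-1, ?_, by simp⟩
      rw [Subgroup.mem_center_iff]
      intro g; simp

theorem exists_lift (x : PSL2R) : ∃ M, toPSL M = x := QuotientGroup.mk'_surjective _ x

theorem toPSL_neg (M : SL(2, ℝ)) : toPSL (-M) = toPSL M :=
  toPSL_eq_iff.2 (.inr (neg_neg M).symm)

theorem coe_iota (p : ℕ) : ((iota p : heckeGroup p) : PSL2R) = toPSL matS := rfl

/-- The lift of `ι γ_p ^ k` which has nonnegative entries for `0 < k < p`. -/
def uMat (p k : ℕ) : SL(2, ℝ) := matS⁻¹ * (matS * matT p) ^ k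

/-- The lift of a word in the `ι γ_p ^ k`. -/
def wMat (p : ℕ) (l : List ℕ) : SL(2, ℝ) := (l.map (uMat p)).prod

@[simp] theorem wMat_nil (p : ℕ) : wMat p [] = 1 := rfl

@[simp] theorem wMat_cons (p k : ℕ) (l : List ℕ) : wMat p (k :: l) = uMat p k * wMat p l := by
  simp [wMat]

theorem matS_sq : matS * matS = -1 := by
  apply ext_two <;> simp [mul_apply_two, neg_apply_two]

theorem matS_inv : matS⁻¹ = -matS := by
  apply ext_two <;> simp [neg_apply_two]

theorem iota_mul_self (p : ℕ) : iota p * iota p = 1 := by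
  apply Subtype.ext
  show toPSL matS * toPSL matS = 1
  rw [← map_mul, matS_sq, toPSL_neg, map_one]

theorem coe_iota_mul_gam_pow (p k : ℕ) :
    ((iota p * gam p ^ k : heckeGroup p) : PSL2R) = toPSL (uMat p k) := by
  rw [uMat, matS_inv, neg_mul, toPSL_neg, map_mul, map_pow]
  rfl

theorem coe_word (p : ℕ) (l : List ℕ) :
    ((word (iota p) (gam p) l : heckeGroup p) : PSL2R) = toPSL (wMat p l) := by
  induction l with
  | nil => simp
  | cons k l ih =>
    rw [word_cons, wMat_cons, map_mul, ← ih, ← coe_iota_mul_gam_pow]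
    rfl

theorem closure_iota_gam (p : ℕ) : Subgroup.closure {iota p, gam p} = ⊤ := by
  rw [eq_top_iff]
  have h : Subgroup.closure (Subtype.val ⁻¹' {toPSL matS, toPSL (matT p)} :
      Set (heckeGroup p)) = ⊤ := Subgroup.closure_closure_coe_preimage
  rw [← h, Subgroup.closure_le]
  have hi : iota p ∈ Subgroup.closure {iota p, gam p} := Subgroup.subset_closure (by simp)
  have hg : gam p ∈ Subgroup.closure {iota p, gam p} := Subgroup.subset_closure (by simp)
  rintro x (hx | hx)
  · have : x = iota p := Subtype.ext hx
    rw [this]; exact hi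
  · have : x = alpha p := Subtype.ext hx
    have e : alpha p = (iota p)⁻¹ * gam p := by rw [gam]; group
    rw [this, e]
    exact mul_mem (inv_mem hi) hg

/-! ### Powers of the rotation and their entries -/

section Trig

variable {p : ℕ}

theorem angle_pos (hp : 3 ≤ p) : 0 < Real.pi / p := by
  have : (0 : ℝ) < p := by positivity
  positivity

theorem mul_angle (hp : 3 ≤ p) : (p : ℝ) * (Real.pi / p) = Real.pi := by
  have : (p : ℝ) ≠ 0 := by positivity
  field_simp

theorem angle_lt (hp : 3 ≤ p) : Real.pi / p < Real.pi / 2 := by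
  have h3 : (3 : ℝ) ≤ p := by exact_mod_cast hp
  exact div_lt_div_of_pos_left Real.pi_pos two_pos (by linarith)

theorem sin_angle_pos (hp : 3 ≤ p) : 0 < Real.sin (Real.pi / p) :=
  Real.sin_pos_of_pos_of_lt_pi (angle_pos hp) (by linarith [angle_lt hp, angle_pos hp])

theorem cos_angle_pos (hp : 3 ≤ p) : 0 < Real.cos (Real.pi / p) :=
  Real.cos_pos_of_mem_Ioo ⟨by linarith [angle_lt hp, angle_pos hp], angle_lt hp⟩

/-- The ratio `sin (x π / p) / sin (π / p)`. -/
def sinRatio (p : ℕ) (x : ℝ) : ℝ := Real.sin (x * (Real.pi / p)) / Real.sin (Real.pi / p)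

theorem sinRatio_zero : sinRatio p 0 = 0 := by simp [sinRatio]

theorem sinRatio_one (hp : 3 ≤ p) : sinRatio p 1 = 1 := by
  simp [sinRatio, (sin_angle_pos hp).ne']

theorem sinRatio_neg (x : ℝ) : sinRatio p (-x) = -sinRatio p x := by
  simp [sinRatio, neg_div]

theorem sinRatio_sub (hp : 3 ≤ p) (x : ℝ) : sinRatio p (p - x) = sinRatio p x := by
  rw [sinRatio, sub_mul, mul_angle hp, Real.sin_pi_sub, sinRatio]

theorem sinRatio_add_one (x : ℝ) :
    sinRatio p (x + 1) = lam p * sinRatio p x - sinRatio p (x - 1) := by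
  simp only [sinRatio, lam, add_mul, sub_mul, one_mul, Real.sin_add, Real.sin_sub]
  ring

theorem sinRatio_lt (hp : 3 ≤ p) {x y : ℝ} (hx : -(p / 2 : ℝ) ≤ x) (hxy : x < y)
    (hy : y ≤ p / 2) : sinRatio p x < sinRatio p y := by
  have h := mul_angle hp
  have h0 := angle_pos hp
  refine div_lt_div_of_pos_right ?_ (sin_angle_pos hp)
  apply Real.sin_lt_sin_of_lt_of_le_pi_div_two
  · nlinarith
  · nlinarith
  · nlinarith

theorem sinRatio_gt (hp : 3 ≤ p) {x y : ℝ} (hx : (p / 2 : ℝ) ≤ x) (hxy : x < y)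
    (hy : y ≤ 3 / 2 * p) : sinRatio p y < sinRatio p x := by
  rw [← sinRatio_sub hp x, ← sinRatio_sub hp y]
  exact sinRatio_lt hp (by linarith) (by linarith) (by linarith)

theorem one_le_sinRatio (hp : 3 ≤ p) {k : ℕ} (h0 : 0 < k) (hk : k < p) :
    1 ≤ sinRatio p k := by
  have h3 : (3 : ℝ) ≤ p := by exact_mod_cast hp
  have hk0 : (1 : ℝ) ≤ k := by exact_mod_cast h0
  have hkp : (k : ℝ) + 1 ≤ p := by exact_mod_cast hk
  rw [← sinRatio_one hp]
  rcases le_total (k : ℝ) (p / 2) with h | h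
  · rcases hk0.eq_or_lt with h1 | h1
    · rw [← h1]
    · exact (sinRatio_lt hp (by linarith) h1 h).le
  · rw [← sinRatio_sub hp (k : ℝ)]
    rcases (show (1 : ℝ) ≤ p - k by linarith).eq_or_lt with h1 | h1
    · rw [← h1]
    · exact (sinRatio_lt hp (by linarith) h1 (by linarith)).le

theorem sinRatio_nonneg (hp : 3 ≤ p) {k : ℕ} (hk : k ≤ p) : 0 ≤ sinRatio p k := by
  rcases Nat.eq_zero_or_pos k with rfl | h0
  · simp [sinRatio_zero]
  rcases hk.eq_or_lt with rfl | hk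
  · have := sinRatio_sub hp 0
    rw [sub_zero, sinRatio_zero] at this
    exact this.ge
  · linarith [one_le_sinRatio hp h0 hk]

theorem rotation_pow_entries (hp : 3 ≤ p) (k : ℕ) :
    ((matS * matT p) ^ k) 0 0 = -sinRatio p (k - 1) ∧
    ((matS * matT p) ^ k) 0 1 = -sinRatio p k ∧
    ((matS * matT p) ^ k) 1 0 = sinRatio p k ∧
    ((matS * matT p) ^ k) 1 1 = sinRatio p (k + 1) := by
  induction k with
  | zero => simp [sinRatio_zero, sinRatio_one hp, sinRatio_neg]
  | succ k ih =>
    obtain ⟨h1, h2, h3, h4⟩ := ih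
    have e1 := sinRatio_add_one (p := p) k
    have e2 := sinRatio_add_one (p := p) (k + 1)
    rw [add_sub_cancel_right] at e2
    simp only [pow_succ, mul_apply_two _ (matS * matT p), h1, h2, h3, h4]
    simp only [mul_apply_two matS, matS_00, matS_01, matS_10, matS_11, matT_00, matT_01, matT_10,
      matT_11, Nat.cast_add, Nat.cast_one, add_sub_cancel_right, e2]
    refine ⟨by ring, by rw [e1]; ring, by ring, by ring⟩

theorem uMat_00 (hp : 3 ≤ p) (k : ℕ) : uMat p k 0 0 = sinRatio p k := by
  simp [uMat, mul_apply_two, rotation_pow_entries hp k]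
theorem uMat_01 (hp : 3 ≤ p) (k : ℕ) : uMat p k 0 1 = sinRatio p (k + 1) := by
  simp [uMat, mul_apply_two, rotation_pow_entries hp k]
theorem uMat_10 (hp : 3 ≤ p) (k : ℕ) : uMat p k 1 0 = sinRatio p (k - 1) := by
  simp [uMat, mul_apply_two, rotation_pow_entries hp k]
theorem uMat_11 (hp : 3 ≤ p) (k : ℕ) : uMat p k 1 1 = sinRatio p k := by
  simp [uMat, mul_apply_two, rotation_pow_entries hp k]

theorem sinRatio_self (hp : 3 ≤ p) : sinRatio p p = 0 := by
  have := sinRatio_sub hp 0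
  rwa [sub_zero, sinRatio_zero] at this

theorem gam_pow_coe (p k : ℕ) :
    ((gam p ^ k : heckeGroup p) : PSL2R) = toPSL ((matS * matT p) ^ k) := by
  rw [map_pow]; rfl

theorem gam_pow_ne_one (hp : 3 ≤ p) {k : ℕ} (h0 : 0 < k) (hk : k < p) : gam p ^ k ≠ 1 := by
  intro h
  have h1 : toPSL ((matS * matT p) ^ k) = toPSL 1 := by
    rw [← gam_pow_coe, h]; simp
  have h2 : ((matS * matT p) ^ k) 1 0 = 0 := by
    rcases toPSL_eq_iff.1 h1 with e | e
    · rw [← e]; simp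
    · rw [← neg_neg ((matS * matT p) ^ k), ← e, neg_apply_two]; simp
  rw [(rotation_pow_entries hp k).2.2.1] at h2
  linarith [one_le_sinRatio hp h0 hk]

theorem gam_pow_self (hp : 3 ≤ p) : gam p ^ p = 1 := by
  apply Subtype.ext
  rw [gam_pow_coe]
  have hh : (matS * matT p) ^ p = -1 := by
    obtain ⟨h1, h2, h3, h4⟩ := rotation_pow_entries hp p
    have e1 : sinRatio p (p - 1) = 1 := by rw [sinRatio_sub hp, sinRatio_one hp]
    have e2 : sinRatio p (p + 1) = -1 := by
      have := sinRatio_sub hp (-1)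
      rwa [sub_neg_eq_add, sinRatio_neg, sinRatio_one hp] at this
    apply ext_two <;> simp [neg_apply_two, h1, h2, h3, h4, e1, e2, sinRatio_self hp]
  rw [hh, toPSL_neg]; simp

theorem orderOf_gam (hp : 3 ≤ p) : orderOf (gam p) = p :=
  (orderOf_eq_iff (by omega)).2
    ⟨gam_pow_self hp, fun _ hk h0 => gam_pow_ne_one hp h0 hk⟩

/-! ### Positivity of words and discreteness -/

/-- Nonnegative entries, with diagonal entries at least `1`. -/
structure IsPositive (M : SL(2, ℝ)) : Prop where
  h00 : 1 ≤ M 0 0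
  h01 : 0 ≤ M 0 1
  h10 : 0 ≤ M 1 0
  h11 : 1 ≤ M 1 1

theorem IsPositive.one : IsPositive 1 := ⟨by simp, by simp, by simp, by simp⟩

theorem IsPositive.mul {M N : SL(2, ℝ)} (hM : IsPositive M) (hN : IsPositive N) :
    IsPositive (M * N) := by
  obtain ⟨a, b, c, d⟩ := hM
  obtain ⟨a', b', c', d'⟩ := hN
  constructor <;> rw [mul_apply_two]
  · nlinarith [mul_nonneg b c']
  · nlinarith [mul_nonneg b (zero_le_one.trans d'), mul_nonneg (zero_le_one.trans a) b']
  · nlinarith [mul_nonneg c (zero_le_one.trans a'), mul_nonneg (zero_le_one.trans d) c']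
  · nlinarith [mul_nonneg c b']

theorem isPositive_uMat (hp : 3 ≤ p) {k : ℕ} (h0 : 0 < k) (hk : k < p) :
    IsPositive (uMat p k) := by
  have h1 := one_le_sinRatio hp h0 hk
  have h2 := sinRatio_nonneg hp (k := k + 1) hk
  have h3 := sinRatio_nonneg hp (k := k - 1) (by omega)
  rw [Nat.cast_pred h0] at h3
  push_cast at h2
  exact ⟨by rwa [uMat_00 hp], by rwa [uMat_01 hp], by rwa [uMat_10 hp], by rwa [uMat_11 hp]⟩

theorem isPositive_wMat (hp : 3 ≤ p) {l : List ℕ} (hl : Letters p l) :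
    IsPositive (wMat p l) := by
  induction l with
  | nil => exact IsPositive.one
  | cons k l ih =>
    obtain ⟨⟨h0, hk⟩, hl⟩ := letters_cons.1 hl
    rw [wMat_cons]
    exact (isPositive_uMat hp h0 hk).mul (ih hl)

/-- One of the off-diagonal entries of each letter is at least `1`, so every letter increases the
sum of the entries of a word by at least `1`. -/
theorem length_le_wMat (hp : 3 ≤ p) {l : List ℕ} (hl : Letters p l) :
    (l.length : ℝ) ≤ wMat p l 0 0 + wMat p l 0 1 + wMat p l 1 0 + wMat p l 1 1 := by
  induction l with
  | nil => simp
  | cons k l ih =>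
    obtain ⟨⟨h0, hk⟩, hl⟩ := letters_cons.1 hl
    obtain ⟨a, b, c, d⟩ := isPositive_uMat hp h0 hk
    obtain ⟨a', b', c', d'⟩ := isPositive_wMat hp hl
    have ih := ih hl
    have hor : 1 ≤ uMat p k 0 1 ∨ 1 ≤ uMat p k 1 0 := by
      rcases Nat.lt_or_ge (k + 1) p with h | h
      · left
        have := one_le_sinRatio hp (k := k + 1) (by omega) h
        push_cast at this
        rwa [uMat_01 hp]
      · right
        have := one_le_sinRatio hp (k := k - 1) (by omega) (by omega)
        rw [Nat.cast_pred h0] at this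
        rwa [uMat_10 hp]
    simp only [wMat_cons, List.length_cons, mul_apply_two]
    push_cast
    set W := wMat p l
    set U := uMat p k
    have t1 := mul_nonneg (sub_nonneg.2 a) (zero_le_one.trans a')
    have t2 := mul_nonneg (sub_nonneg.2 a) b'
    have t3 := mul_nonneg (sub_nonneg.2 d) c'
    have t4 := mul_nonneg (sub_nonneg.2 d) (zero_le_one.trans d')
    have t5 := mul_nonneg b c'
    have t6 := mul_nonneg c b'
    rcases hor with h | h
    · nlinarith [mul_nonneg (sub_nonneg.2 h) (zero_le_one.trans d'),
        mul_nonneg c (zero_le_one.trans a')]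
    · nlinarith [mul_nonneg (sub_nonneg.2 h) (zero_le_one.trans a'),
        mul_nonneg b (zero_le_one.trans d')]

theorem isNormalForm (hp : 3 ≤ p) (x : heckeGroup p) :
    IsNormalForm (iota p) (gam p) p x :=
  isNormalForm_of_mem_closure (iota_mul_self p) (gam_pow_self hp) (by omega)
    (by rw [closure_iota_gam]; trivial)

theorem coe_normalForm (p : ℕ) (l : List ℕ) (a b : ℕ) :
    ((iota p ^ a * word (iota p) (gam p) l * iota p ^ b : heckeGroup p) : PSL2R) =
      toPSL (matS ^ a * wMat p l * matS ^ b) := by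
  rw [map_mul, map_mul, ← coe_word, map_pow, map_pow]
  rfl

theorem sum_abs_normalForm (W : SL(2, ℝ)) {a b : ℕ} (ha : a < 2) (hb : b < 2) (M : SL(2, ℝ))
    (h : M = matS ^ a * W * matS ^ b ∨ M = -(matS ^ a * W * matS ^ b)) :
    |M 0 0| + |M 0 1| + |M 1 0| + |M 1 1| = |W 0 0| + |W 0 1| + |W 1 0| + |W 1 1| := by
  rcases h with rfl | rfl <;> interval_cases a <;> interval_cases b <;>
    simp [mul_apply_two, neg_apply_two] <;> ring

/-- Discreteness of `Γ_p`: a bound on the entries of a lift bounds the length of the word. -/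
theorem finite_bounded (hp : 3 ≤ p) (R : ℝ) :
    {x : heckeGroup p | ∃ M, toPSL M = x ∧ ∀ i j, |M i j| ≤ R}.Finite := by
  obtain ⟨n, hn⟩ := exists_nat_ge (4 * R)
  have hf := List.finite_length_le (Fin p) n
  have hf2 := ((hf.prod (Set.finite_lt_nat 2)).prod (Set.finite_lt_nat 2)).image
    (fun y : (List (Fin p) × ℕ) × ℕ =>
      iota p ^ y.1.2 * word (iota p) (gam p) (y.1.1.map Fin.val) * iota p ^ y.2)
  refine hf2.subset ?_
  rintro x ⟨M, hM, hR⟩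
  obtain ⟨l, hl, a, b, ha, hb, rfl⟩ := isNormalForm hp x
  have h1 := length_le_wMat hp hl
  rw [coe_normalForm] at hM
  have hM' := sum_abs_normalForm (wMat p l) ha hb M (toPSL_eq_iff.1 hM.symm)
  have hlen : l.length ≤ n := by
    have : (l.length : ℝ) ≤ n := by
      have := le_abs_self (wMat p l 0 0)
      have := le_abs_self (wMat p l 0 1)
      have := le_abs_self (wMat p l 1 0)
      have := le_abs_self (wMat p l 1 1)
      linarith [hR 0 0, hR 0 1, hR 1 0, hR 1 1]
    exact_mod_cast this
  obtain ⟨l', rfl⟩ : ∃ l' : List (Fin p), l'.map Fin.val = l := by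
    refine ⟨l.pmap (fun k hk => (⟨k, hk⟩ : Fin p)) fun k hk => (hl k hk).2, ?_⟩
    rw [List.map_pmap]
    simp
  exact ⟨((l', a), b), ⟨⟨by simpa using hlen, ha⟩, hb⟩, rfl⟩

end Trig

/-! ### Hyperbolic elements and their reciprocators -/

theorem matrix_isHyperbolic_iff (M : SL(2, ℝ)) :
    (M : Matrix (Fin 2) (Fin 2) ℝ).IsHyperbolic ↔ 4 < (M 0 0 + M 1 1) ^ 2 := by
  rw [Matrix.IsHyperbolic, Matrix.discr_fin_two, Matrix.trace_fin_two, M.det_coe]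
  constructor <;> intro h <;> linarith

theorem isHyperbolic_toPSL (M : SL(2, ℝ)) :
    IsHyperbolic (toPSL M) ↔ 4 < (M 0 0 + M 1 1) ^ 2 := by
  constructor
  · rintro ⟨N, hN, h⟩
    rw [matrix_isHyperbolic_iff] at h
    rcases toPSL_eq_iff.1 hN with rfl | rfl
    · exact h
    · rw [neg_apply_two, neg_apply_two]; nlinarith
  · exact fun h => ⟨M, rfl, (matrix_isHyperbolic_iff M).2 h⟩

theorem trace_conj (X M : SL(2, ℝ)) :
    (X * M * X⁻¹) 0 0 + (X * M * X⁻¹) 1 1 = M 0 0 + M 1 1 := by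
  simp only [mul_apply_two, inv_apply_00, inv_apply_01, inv_apply_10, inv_apply_11]
  linear_combination (M 0 0 + M 1 1) * det_two X

theorem IsHyperbolic.conj {g : PSL2R} (hg : IsHyperbolic g) (x : PSL2R) :
    IsHyperbolic (x * g * x⁻¹) := by
  obtain ⟨X, rfl⟩ := exists_lift x
  obtain ⟨M, rfl⟩ := exists_lift g
  rw [isHyperbolic_toPSL] at hg
  rw [← map_mul, ← map_inv, ← map_mul, isHyperbolic_toPSL, trace_conj]
  exact hg

theorem isHyperbolic_of_mem_conjugatesOf {p : ℕ} {r g : heckeGroup p}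
    (hr : IsHyperbolic (r : PSL2R)) (hg : g ∈ conjugatesOf r) : IsHyperbolic (g : PSL2R) := by
  obtain ⟨x, rfl⟩ := isConj_iff.1 hg
  exact hr.conj x

/-- `H M = M⁻¹ H` says that `H` has trace zero and is orthogonal to `M` for the trace form. -/
theorem isReciprocator_toPSL {H M : SL(2, ℝ)} (hM : 4 < (M 0 0 + M 1 1) ^ 2) :
    IsReciprocator (toPSL H) (toPSL M) ↔
      H 0 0 + H 1 1 = 0 ∧ H 0 0 * (M 0 0 - M 1 1) + H 0 1 * M 1 0 + H 1 0 * M 0 1 = 0 := by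
  have hdM := det_two M
  have key : IsReciprocator (toPSL H) (toPSL M) ↔ H * M = M⁻¹ * H := by
    unfold IsReciprocator
    rw [← map_mul, ← map_inv, ← map_mul, ← map_inv, toPSL_eq_iff]
    constructor
    · rintro (h | h)
      · rw [h]; group
      · exfalso
        have ht := trace_conj H M
        rw [← neg_neg (H * M * H⁻¹), ← h] at ht
        simp only [neg_apply_two, inv_apply_00, inv_apply_11] at ht
        nlinarith
    · intro h; left; rw [h]; group
  rw [key]
  constructor
  · intro h
    have h00 : (H * M) 0 0 = (M⁻¹ * H) 0 0 := by rw [h]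
    have h01 : (H * M) 0 1 = (M⁻¹ * H) 0 1 := by rw [h]
    have h10 : (H * M) 1 0 = (M⁻¹ * H) 1 0 := by rw [h]
    have h11 : (H * M) 1 1 = (M⁻¹ * H) 1 1 := by rw [h]
    simp only [mul_apply_two, inv_apply_00, inv_apply_01, inv_apply_10, inv_apply_11]
      at h00 h01 h10 h11
    refine ⟨?_, by linarith⟩
    by_contra hne
    have e1 : M 0 1 = 0 := by
      have : M 0 1 * (H 0 0 + H 1 1) = 0 := by linarith
      exact (mul_eq_zero.1 this).resolve_right hne
    have e2 : M 0 0 - M 1 1 = 0 := by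
      have : (M 0 0 - M 1 1) * (H 0 0 + H 1 1) = 0 := by linarith
      exact (mul_eq_zero.1 this).resolve_right hne
    rw [e1] at hdM
    nlinarith
  · rintro ⟨h1, h2⟩
    have e : H 1 1 = -H 0 0 := by linarith
    apply ext_two <;>
      simp only [mul_apply_two, inv_apply_00, inv_apply_01, inv_apply_10, inv_apply_11, e] <;>
      linarith

theorem isReciprocator_coe {p : ℕ} {h g : heckeGroup p} :
    IsReciprocator h g ↔ IsReciprocator (h : PSL2R) (g : PSL2R) := by
  unfold IsReciprocator
  rw [Subtype.ext_iff]
  rfl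

/-- Reciprocators of hyperbolic elements are elliptic of order two. -/
theorem IsReciprocator.lift_trace {p : ℕ} {h g : heckeGroup p} (hg : IsHyperbolic (g : PSL2R))
    (hr : IsReciprocator h g) {H : SL(2, ℝ)} (hH : toPSL H = h) : H 0 0 + H 1 1 = 0 := by
  obtain ⟨M, hM⟩ := exists_lift (g : PSL2R)
  rw [isReciprocator_coe, ← hM, ← hH] at hr
  rw [← hM, isHyperbolic_toPSL] at hg
  exact ((isReciprocator_toPSL hg).1 hr).1

theorem sq_eq_neg_one {H : SL(2, ℝ)} (h : H 0 0 + H 1 1 = 0) : H * H = -1 := by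
  have hd := det_two H
  have e : H 1 1 = -H 0 0 := by linarith
  rw [e] at hd
  apply ext_two <;> simp [mul_apply_two, neg_apply_two, e] <;> linarith

theorem mul_self_of_isReciprocator {p : ℕ} {h g : heckeGroup p}
    (hg : IsHyperbolic (g : PSL2R)) (hr : IsReciprocator h g) : h * h = 1 := by
  obtain ⟨H, hH⟩ := exists_lift (h : PSL2R)
  apply Subtype.ext
  show (h : PSL2R) * h = 1
  rw [← hH, ← map_mul, sq_eq_neg_one (hr.lift_trace hg hH), toPSL_neg, map_one]

theorem inv_ne_self_of_isHyperbolic {p : ℕ} {g : heckeGroup p} (hg : IsHyperbolic (g : PSL2R)) :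
    g⁻¹ ≠ g := by
  intro h
  have h1 : IsReciprocator 1 g := by simp [IsReciprocator, h]
  have := h1.lift_trace hg (H := 1) (by simp)
  norm_num at this

theorem commute_toPSL {X M : SL(2, ℝ)} (h : Commute (toPSL X) (toPSL M)) :
    X * M = M * X ∨ X * M = -(M * X) := by
  have := h.eq
  rw [← map_mul, ← map_mul] at this
  exact toPSL_eq_iff.1 this.symm

theorem commute_toPSL_of_trace {X M : SL(2, ℝ)} (hM : M 0 0 + M 1 1 ≠ 0)
    (h : Commute (toPSL X) (toPSL M)) : X * M = M * X := by
  refine (commute_toPSL h).resolve_right fun h => hM ?_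
  have ht := trace_conj X M
  have : X * M * X⁻¹ = -M := by rw [h, neg_mul]; group
  rw [this, neg_apply_two, neg_apply_two] at ht
  linarith

/-! ### Centralizers of hyperbolic elements -/

/-- The diagonal matrix with entries `exp y`, `exp (-y)`. -/
def diagExp (y : ℝ) : SL(2, ℝ) :=
  ⟨!![Real.exp y, 0; 0, Real.exp (-y)], by simp [Matrix.det_fin_two, ← Real.exp_add]⟩

@[simp] theorem diagExp_00 (y : ℝ) : diagExp y 0 0 = Real.exp y := rfl
@[simp] theorem diagExp_01 (y : ℝ) : diagExp y 0 1 = 0 := rfl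
@[simp] theorem diagExp_10 (y : ℝ) : diagExp y 1 0 = 0 := rfl
@[simp] theorem diagExp_11 (y : ℝ) : diagExp y 1 1 = Real.exp (-y) := rfl

theorem diagExp_add (y z : ℝ) : diagExp (y + z) = diagExp y * diagExp z := by
  apply ext_two <;> simp [mul_apply_two, Real.exp_add, mul_comm]

theorem diagExp_zero : diagExp 0 = 1 := by
  apply ext_two <;> simp

theorem exists_diag_of_eigenvectors {M : SL(2, ℝ)} {y x₁ x₂ z₁ z₂ : ℝ}
    (hδ : x₁ * z₂ - z₁ * x₂ ≠ 0)
    (h₁ : M 0 0 * x₁ + M 0 1 * x₂ = Real.exp y * x₁)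
    (h₂ : M 1 0 * x₁ + M 1 1 * x₂ = Real.exp y * x₂)
    (h₃ : M 0 0 * z₁ + M 0 1 * z₂ = Real.exp (-y) * z₁)
    (h₄ : M 1 0 * z₁ + M 1 1 * z₂ = Real.exp (-y) * z₂) :
    ∃ P : SL(2, ℝ), M * P = P * diagExp y := by
  set δ := x₁ * z₂ - z₁ * x₂ with hδ'
  obtain ⟨P, h00, h01, h10, h11⟩ : ∃ P : SL(2, ℝ),
      P 0 0 = x₁ ∧ P 0 1 = z₁ / δ ∧ P 1 0 = x₂ ∧ P 1 1 = z₂ / δ := by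
    refine ⟨⟨!![x₁, z₁ / δ; x₂, z₂ / δ], ?_⟩, rfl, rfl, rfl, rfl⟩
    rw [Matrix.det_fin_two_of, ← mul_div_assoc, div_mul_eq_mul_div, ← sub_div, div_self hδ]
  refine ⟨P, ?_⟩
  apply ext_two <;>
    simp only [mul_apply_two, h00, h01, h10, h11, diagExp_00, diagExp_01, diagExp_10, diagExp_11]
  · linear_combination h₁
  · linear_combination h₃ / δ
  · linear_combination h₂
  · linear_combination h₄ / δ

/-- A matrix of trace greater than `2` is diagonalizable in `SL(2, ℝ)`. -/
theorem exists_diag_of_pos {M : SL(2, ℝ)} (hM : 2 < M 0 0 + M 1 1) :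
    ∃ (P : SL(2, ℝ)) (y : ℝ), y ≠ 0 ∧ M * P = P * diagExp y := by
  have hd := det_two M
  set τ := M 0 0 + M 1 1 with hτ
  have hs : √(τ ^ 2 - 4) ^ 2 = τ ^ 2 - 4 := Real.sq_sqrt (by nlinarith)
  have hs0 : 0 < √(τ ^ 2 - 4) := Real.sqrt_pos.2 (by nlinarith)
  -- the larger eigenvalue
  obtain ⟨u, hu⟩ : ∃ u, u = (τ + √(τ ^ 2 - 4)) / 2 := ⟨_, rfl⟩
  have hu1 : 1 < u := by rw [hu]; linarith
  have hu0 : u ≠ 0 := by linarith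
  have hq : u ^ 2 - τ * u + 1 = 0 := by rw [hu]; linear_combination hs / 4
  have hy : Real.exp (Real.log u) = u := Real.exp_log (by linarith)
  have hv : u⁻¹ = τ - u := by field_simp; linear_combination hq
  have hy' : Real.exp (-Real.log u) = τ - u := by rw [Real.exp_neg, hy, hv]
  have huv : u - (τ - u) ≠ 0 := by
    rw [← hv]; have := inv_lt_one_of_one_lt₀ hu1; linarith
  have hlog : Real.log u ≠ 0 := (Real.log_pos hu1).ne'
  rw [hτ] at hq
  by_cases hb : M 0 1 = 0
  · by_cases hc : M 1 0 = 0
    · have hd' : M 0 0 * M 1 1 = 1 := by rw [hb] at hd; linarith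
      have ha : 0 < M 0 0 := by nlinarith
      have ha1 : M 0 0 ≠ 1 := by
        intro h; rw [h] at hd' hτ; linarith
      refine ⟨1, Real.log (M 0 0), Real.log_ne_zero_of_pos_of_ne_one ha ha1, ?_⟩
      have e1 : Real.exp (Real.log (M 0 0)) = M 0 0 := Real.exp_log ha
      have e2 : Real.exp (-Real.log (M 0 0)) = M 1 1 := by
        rw [Real.exp_neg, e1]; exact (eq_inv_of_mul_eq_one_right hd').symm
      rw [mul_one, one_mul]
      apply ext_two <;> simp [e1, e2, hb, hc]
    · obtain ⟨P, hP⟩ := exists_diag_of_eigenvectors (M := M) (y := Real.log u)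
        (x₁ := u - M 1 1) (x₂ := M 1 0) (z₁ := τ - u - M 1 1) (z₂ := M 1 0)
        (by rw [← sub_mul]; exact mul_ne_zero (by convert huv using 1; ring) hc)
        (by rw [hy]; linear_combination -hq - hd) (by rw [hy]; ring)
        (by rw [hy', hτ]; linear_combination -hq - hd) (by rw [hy', hτ]; ring)
      exact ⟨P, _, hlog, hP⟩
  · obtain ⟨P, hP⟩ := exists_diag_of_eigenvectors (M := M) (y := Real.log u)
      (x₁ := M 0 1) (x₂ := u - M 0 0) (z₁ := M 0 1) (z₂ := τ - u - M 0 0)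
      (by rw [← mul_sub]; exact mul_ne_zero hb (by intro h; apply huv; linarith))
      (by rw [hy]; ring) (by rw [hy]; linear_combination -hq - hd)
      (by rw [hy', hτ]; ring) (by rw [hy', hτ]; linear_combination -hq - hd)
    exact ⟨P, _, hlog, hP⟩

theorem exists_diag {M : SL(2, ℝ)} (hM : 4 < (M 0 0 + M 1 1) ^ 2) :
    ∃ (P : SL(2, ℝ)) (y : ℝ), y ≠ 0 ∧ toPSL M = toPSL (P * diagExp y * P⁻¹) := by
  rcases le_total 0 (M 0 0 + M 1 1) with h | h
  · obtain ⟨P, y, hy, e⟩ := exists_diag_of_pos (M := M) (by nlinarith)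
    exact ⟨P, y, hy, by rw [← e]; group⟩
  · obtain ⟨P, y, hy, e⟩ := exists_diag_of_pos (M := -M) (by
      rw [neg_apply_two, neg_apply_two]; nlinarith)
    exact ⟨P, y, hy, by rw [← e, ← toPSL_neg M]; group⟩

theorem eq_diagExp_of_commute {X : SL(2, ℝ)} {y : ℝ} (hy : y ≠ 0)
    (h : X * diagExp y = diagExp y * X) : ∃ z, toPSL X = toPSL (diagExp z) := by
  have hne : Real.exp y - Real.exp (-y) ≠ 0 := by
    intro e
    have := Real.exp_injective (sub_eq_zero.1 e)
    exact hy (by linarith)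
  have h01 : (X * diagExp y) 0 1 = (diagExp y * X) 0 1 := by rw [h]
  have h10 : (X * diagExp y) 1 0 = (diagExp y * X) 1 0 := by rw [h]
  simp [mul_apply_two] at h01 h10
  have e01 : X 0 1 = 0 := by
    have : X 0 1 * (Real.exp y - Real.exp (-y)) = 0 := by linarith
    exact (mul_eq_zero.1 this).resolve_right hne
  have e10 : X 1 0 = 0 := by
    have : X 1 0 * (Real.exp y - Real.exp (-y)) = 0 := by linarith
    exact (mul_eq_zero.1 this).resolve_right hne
  have hd := det_two X
  rw [e01, zero_mul, sub_zero] at hd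
  have h0 : X 0 0 ≠ 0 := by rintro h; rw [h] at hd; simp at hd
  have h1 : X 1 1 = (X 0 0)⁻¹ := eq_inv_of_mul_eq_one_right hd
  refine ⟨Real.log (X 0 0), ?_⟩
  rw [toPSL_eq_iff]
  rcases lt_or_gt_of_ne h0 with hlt | hgt
  · right
    apply ext_two <;>
      simp [Real.exp_neg, Real.exp_log_of_neg hlt, e01, e10, h1, neg_apply_two, inv_neg]
  · left
    apply ext_two <;> simp [Real.exp_neg, Real.exp_log hgt, e01, e10, h1]

theorem toPSL_diagExp_eq_one {y : ℝ} (h : toPSL (diagExp y) = 1) : y = 0 := by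
  rw [← map_one toPSL, toPSL_eq_iff] at h
  rcases h with h | h
  · have : (1 : SL(2, ℝ)) 0 0 = diagExp y 0 0 := by rw [h]
    simp only [one_apply_00, diagExp_00] at this
    exact Real.exp_eq_one_iff y |>.1 this.symm
  · have : (1 : SL(2, ℝ)) 0 0 = (-diagExp y) 0 0 := by rw [h]
    rw [neg_apply_two] at this
    simp at this
    linarith [Real.exp_pos y]

/-- The one-parameter group of `PSL(2, ℝ)` with the eigenvectors given by `P`. -/
def oneParam (P : SL(2, ℝ)) (y : ℝ) : PSL2R := toPSL (P * diagExp y * P⁻¹)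

theorem oneParam_add (P : SL(2, ℝ)) (y z : ℝ) :
    oneParam P (y + z) = oneParam P y * oneParam P z := by
  rw [oneParam, oneParam, oneParam, ← map_mul, diagExp_add]
  congr 1; group

theorem oneParam_zero (P : SL(2, ℝ)) : oneParam P 0 = 1 := by
  simp [oneParam, diagExp_zero]

theorem oneParam_neg (P : SL(2, ℝ)) (y : ℝ) : oneParam P (-y) = (oneParam P y)⁻¹ := by
  rw [eq_inv_iff_mul_eq_one, ← oneParam_add, neg_add_cancel, oneParam_zero]

theorem oneParam_zsmul (P : SL(2, ℝ)) (y : ℝ) (k : ℤ) :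
    oneParam P (k • y) = oneParam P y ^ k := by
  let f : Multiplicative ℝ →* PSL2R :=
    { toFun := fun y => oneParam P y.toAdd
      map_one' := oneParam_zero P
      map_mul' := fun a b => oneParam_add P _ _ }
  exact map_zpow f (Multiplicative.ofAdd y) k

theorem oneParam_eq_one {P : SL(2, ℝ)} {y : ℝ} (h : oneParam P y = 1) : y = 0 := by
  apply toPSL_diagExp_eq_one
  rw [oneParam, map_mul, map_mul, map_inv, conj_eq_one_iff] at h
  exact h

theorem oneParam_injective (P : SL(2, ℝ)) : Function.Injective (oneParam P) := by
  intro y z h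
  have : oneParam P (y + -z) = 1 := by rw [oneParam_add, oneParam_neg, h, mul_inv_cancel]
  linarith [oneParam_eq_one this]

/-- The parameters of the elements of `Γ_p` in a one-parameter group. -/
def paramGroup (p : ℕ) (P : SL(2, ℝ)) : AddSubgroup ℝ where
  carrier := {y | oneParam P y ∈ heckeGroup p}
  zero_mem' := by
    rw [Set.mem_ofPred_eq, oneParam_zero]; exact one_mem _
  add_mem' := by
    intro a b ha hb
    rw [Set.mem_ofPred_eq] at *
    rw [oneParam_add]; exact mul_mem ha hb
  neg_mem' := by
    intro a ha
    rw [Set.mem_ofPred_eq] at *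
    rw [oneParam_neg]; exact inv_mem ha

theorem mem_paramGroup {p : ℕ} {P : SL(2, ℝ)} {y : ℝ} :
    y ∈ paramGroup p P ↔ oneParam P y ∈ heckeGroup p := Iff.rfl

theorem abs_apply_le_sum (P : SL(2, ℝ)) (i j : Fin 2) :
    |P i j| ≤ |P 0 0| + |P 0 1| + |P 1 0| + |P 1 1| := by
  have h1 := abs_nonneg (P 0 0)
  have h2 := abs_nonneg (P 0 1)
  have h3 := abs_nonneg (P 1 0)
  have h4 := abs_nonneg (P 1 1)
  fin_cases i <;> fin_cases j <;> simp <;> linarith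

theorem exists_bound_diagExp (P : SL(2, ℝ)) :
    ∃ R : ℝ, ∀ y, 0 < y → y < 1 → ∀ i j, |(P * diagExp y * P⁻¹) i j| ≤ R := by
  set K := |P 0 0| + |P 0 1| + |P 1 0| + |P 1 1| with hK
  set K' := |P⁻¹ 0 0| + |P⁻¹ 0 1| + |P⁻¹ 1 0| + |P⁻¹ 1 1| with hK'
  refine ⟨2 * (K * Real.exp 1 * K'), fun y h0 h1 i j => ?_⟩
  have e1 : Real.exp y ≤ Real.exp 1 := Real.exp_le_exp.2 h1.le
  have e2 : Real.exp (-y) ≤ Real.exp 1 := Real.exp_le_exp.2 (by linarith)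
  have hP := abs_apply_le_sum P
  have hQ := abs_apply_le_sum P⁻¹
  have hK0 : 0 ≤ K := (abs_nonneg _).trans (hP 0 0)
  have a1 : |P i 0 * Real.exp y * P⁻¹ 0 j| ≤ K * Real.exp 1 * K' := by
    rw [abs_mul, abs_mul, Real.abs_exp]
    exact mul_le_mul (mul_le_mul (hP _ _) e1 (Real.exp_pos _).le hK0) (hQ _ _) (abs_nonneg _)
      (mul_nonneg hK0 (Real.exp_pos _).le)
  have a2 : |P i 1 * Real.exp (-y) * P⁻¹ 1 j| ≤ K * Real.exp 1 * K' := by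
    rw [abs_mul, abs_mul, Real.abs_exp]
    exact mul_le_mul (mul_le_mul (hP _ _) e2 (Real.exp_pos _).le hK0) (hQ _ _) (abs_nonneg _)
      (mul_nonneg hK0 (Real.exp_pos _).le)
  have : (P * diagExp y * P⁻¹) i j =
      P i 0 * Real.exp y * P⁻¹ 0 j + P i 1 * Real.exp (-y) * P⁻¹ 1 j := by
    rw [mul_apply_two, mul_apply_two P, mul_apply_two P, diagExp_00, diagExp_01, diagExp_10,
      diagExp_11]
    ring
  rw [this]
  exact (abs_add_le _ _).trans (by linarith)

/-- The parameters in `(0, 1)` form a finite set, as `Γ_p` is discrete, so the parameters form a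
cyclic group. -/
theorem exists_generator {p : ℕ} (hp : 3 ≤ p) (P : SL(2, ℝ)) :
    ∃ b ∈ paramGroup p P, ∀ y ∈ paramGroup p P, ∃ k : ℤ, y = k • b := by
  set F := {y | y ∈ paramGroup p P ∧ 0 < y ∧ y < 1}
  have hF : F.Finite := by
    obtain ⟨R, hR⟩ := exists_bound_diagExp P
    have hfin := (finite_bounded hp R).image (Subtype.val)
    refine Set.Finite.of_finite_image (hfin.subset ?_) (oneParam_injective P).injOn
    rintro _ ⟨y, ⟨hy, h0, h1⟩, rfl⟩
    exact ⟨⟨_, hy⟩, ⟨_, rfl, hR y h0 h1⟩, rfl⟩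
  obtain ⟨a, ha0, ha⟩ : ∃ a : ℝ, 0 < a ∧
      Disjoint (paramGroup p P : Set ℝ) (Set.Ioo 0 a) := by
    rcases F.eq_empty_or_nonempty with hE | hN
    · refine ⟨1, one_pos, Set.disjoint_left.2 fun y hy hy' => ?_⟩
      have : y ∈ F := ⟨hy, hy'⟩
      rw [hE] at this
      exact this
    · obtain ⟨a, haF, hmin⟩ := Set.exists_min_image F id hF hN
      refine ⟨a, haF.2.1, Set.disjoint_left.2 fun y hy hy' => ?_⟩
      exact absurd (hmin y ⟨hy, hy'.1, hy'.2.trans haF.2.2⟩) (not_le.2 hy'.2)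
  obtain ⟨b, hb⟩ := AddSubgroup.cyclic_of_isolated_zero ha0 ha
  refine ⟨b, by rw [hb]; exact AddSubgroup.subset_closure rfl, fun y hy => ?_⟩
  rw [hb, AddSubgroup.mem_closure_singleton] at hy
  obtain ⟨k, hk⟩ := hy
  exact ⟨k, hk.symm⟩

/-- The centralizer of a hyperbolic element of `Γ_p` is infinite cyclic: it lies in a one-parameter
group, where `Γ_p` is discrete. -/
theorem exists_dihedralData {p : ℕ} (hp : 3 ≤ p) {r h : heckeGroup p}
    (hr : IsHyperbolic (r : PSL2R)) (hh : IsReciprocator h r) : ∃ t, DihedralData r t h := by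
  obtain ⟨M, hM⟩ := exists_lift (r : PSL2R)
  have hM4 := hr
  rw [← hM, isHyperbolic_toPSL] at hM4
  obtain ⟨P, y₀, hy₀, hMP⟩ := exists_diag hM4
  have hr₀ : (r : PSL2R) = oneParam P y₀ := by rw [← hM, hMP]; rfl
  obtain ⟨b, hbG, hb⟩ := exists_generator hp P
  obtain ⟨n, hn⟩ := hb y₀ (by rw [mem_paramGroup, ← hr₀]; exact r.2)
  have hb0 : b ≠ 0 := by rintro rfl; simp at hn; exact hy₀ hn
  have hcomm : ∀ y, oneParam P y * r = r * oneParam P y := fun y => by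
    rw [hr₀, ← oneParam_add, ← oneParam_add, add_comm]
  refine ⟨⟨oneParam P b, hbG⟩, fun k hk => mul_self_of_isReciprocator hr hk,
    Subtype.ext (hcomm b), fun z hz => ?_, fun k hk => ?_, hh⟩
  · obtain ⟨Z, hZ⟩ := exists_lift (z : PSL2R)
    have hz' : Commute (toPSL Z) (toPSL (P * diagExp y₀ * P⁻¹)) := by
      rw [hZ, ← hMP, hM]
      exact congrArg Subtype.val hz.eq
    have htr : (P * diagExp y₀ * P⁻¹) 0 0 + (P * diagExp y₀ * P⁻¹) 1 1 ≠ 0 := by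
      rw [trace_conj, diagExp_00, diagExp_11]
      positivity
    have hc := commute_toPSL_of_trace htr hz'
    obtain ⟨y, hy⟩ := eq_diagExp_of_commute (X := P⁻¹ * Z * P) hy₀ (by
      calc P⁻¹ * Z * P * diagExp y₀ = P⁻¹ * (Z * (P * diagExp y₀ * P⁻¹)) * P := by group
        _ = _ := by rw [hc]; group)
    have hzy : (z : PSL2R) = oneParam P y := by
      rw [oneParam, map_mul, map_mul, ← hy, ← map_mul, ← map_mul, ← hZ]
      congr 1; group
    obtain ⟨k, hk⟩ := hb y (by rw [mem_paramGroup, ← hzy]; exact z.2)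
    refine ⟨k, Subtype.ext ?_⟩
    rw [hzy, hk, oneParam_zsmul]
    rfl
  · have h1 : oneParam P (k • b) = 1 := by
      rw [oneParam_zsmul]; exact congrArg Subtype.val hk
    have := oneParam_eq_one h1
    rw [zsmul_eq_mul, mul_eq_zero] at this
    exact_mod_cast this.resolve_right hb0

/-! ### Involutions and their centralizers -/

section Involutions

variable {p : ℕ}

theorem lift_trace_of_isConj {x y : heckeGroup p} (h : IsConj x y) {X Y : SL(2, ℝ)}
    (hX : toPSL X = x) (hY : toPSL Y = y) (h0 : X 0 0 + X 1 1 = 0) : Y 0 0 + Y 1 1 = 0 := by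
  obtain ⟨z, rfl⟩ := isConj_iff.1 h
  obtain ⟨Z, hZ⟩ := exists_lift (z : PSL2R)
  have e : toPSL (Z * X * Z⁻¹) = toPSL Y := by
    rw [hY, map_mul, map_mul, map_inv, hX, hZ]; rfl
  have ht := trace_conj Z X
  rcases toPSL_eq_iff.1 e with rfl | rfl
  · linarith
  · rw [neg_apply_two, neg_apply_two]; linarith

theorem rotation_pow_trace (hp : 3 ≤ p) (k : ℕ) :
    ((matS * matT p) ^ k) 0 0 + ((matS * matT p) ^ k) 1 1 =
      2 * Real.cos (k * (Real.pi / p)) := by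
  obtain ⟨h1, -, -, h4⟩ := rotation_pow_entries hp k
  rw [h1, h4]
  have := (sin_angle_pos hp).ne'
  simp only [sinRatio, add_mul, sub_mul, one_mul, Real.sin_add, Real.sin_sub]
  field_simp
  ring

theorem two_mul_eq_of_cos_eq_zero (hp : 3 ≤ p) {k : ℕ} (hk : k < p)
    (h : Real.cos (k * (Real.pi / p)) = 0) : p = 2 * k := by
  have ha := angle_pos hp
  have hpa := mul_angle hp
  have hkp : (k : ℝ) < p := by exact_mod_cast hk
  have h1 : (k : ℝ) * (Real.pi / p) = Real.pi / 2 := by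
    apply Real.injOn_cos
    · exact ⟨by positivity, by nlinarith⟩
    · exact ⟨by positivity, by linarith [Real.pi_pos]⟩
    · rw [h, Real.cos_pi_div_two]
  have h2 : (p : ℝ) = 2 * k := by
    have : (2 * k - p : ℝ) * (Real.pi / p) = 0 := by linarith
    have := (mul_eq_zero.1 this).resolve_right ha.ne'
    linarith
  exact_mod_cast h2

/-- An element with a lift of trace zero is conjugate to `ι` or, for even `p`, to `γ_p ^ (p / 2)`:
nonempty words have trace at least `2`. -/
theorem isConj_of_lift_trace (hp : 3 ≤ p) {h : heckeGroup p} {H : SL(2, ℝ)}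
    (hH : toPSL H = h) (h0 : H 0 0 + H 1 1 = 0) :
    IsConj h (iota p) ∨ ∃ m, p = 2 * m ∧ IsConj h (gam p ^ m) := by
  rcases (isNormalForm hp h).isConjStandard (iota_mul_self p) (gam_pow_self hp) with
    hc | ⟨k, hc⟩ | ⟨l, hl, hne, hc⟩
  · exact .inl hc
  · right
    have hk : gam p ^ k = gam p ^ (k % p) := by
      conv_lhs => rw [← pow_mod_orderOf, orderOf_gam hp]
    rw [hk] at hc
    have ht := lift_trace_of_isConj hc hH (gam_pow_coe p (k % p)).symm h0
    rw [rotation_pow_trace hp] at ht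
    exact ⟨k % p, two_mul_eq_of_cos_eq_zero hp (Nat.mod_lt _ (by omega)) (by linarith), hc⟩
  · exfalso
    have ht := lift_trace_of_isConj hc hH (coe_word p l).symm h0
    have hW := isPositive_wMat hp hl
    linarith [hW.h00, hW.h11]

theorem iota_ne_one : iota p ≠ 1 := by
  intro h
  have h1 : toPSL matS = toPSL 1 := congrArg Subtype.val h
  rcases toPSL_eq_iff.1 h1 with e | e
  · have : (1 : SL(2, ℝ)) 0 0 = matS 0 0 := by rw [e]
    simp at this
  · have : (1 : SL(2, ℝ)) 0 0 = (-matS) 0 0 := by rw [e]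
    rw [neg_apply_two] at this
    simp at this

theorem orderOf_iota : orderOf (iota p) = 2 := by
  refine orderOf_eq_prime ?_ iota_ne_one
  rw [pow_two, iota_mul_self]

/-- The stabilizer of `i` in `Γ_p` has order two. -/
theorem exists_eq_iota_pow_of_commute (hp : 3 ≤ p) {z : heckeGroup p} (hz : Commute z (iota p)) :
    ∃ k : ℕ, z = iota p ^ k := by
  obtain ⟨l, hl, a, b, -, -, rfl⟩ := isNormalForm hp z
  have hi : ∀ k : ℕ, Commute (iota p ^ k) (iota p) := fun k => Commute.pow_self _ _
  have hw : Commute (word (iota p) (gam p) l) (iota p) := by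
    have := ((hi a).inv_left.mul_left hz).mul_left (hi b).inv_left
    rwa [show (iota p ^ a)⁻¹ * (iota p ^ a * word (iota p) (gam p) l * iota p ^ b) *
      (iota p ^ b)⁻¹ = word (iota p) (gam p) l by group] at this
  have hw' : Commute (toPSL (wMat p l)) (toPSL matS) := by
    rw [← coe_word]; exact congrArg Subtype.val hw.eq
  have hW := isPositive_wMat hp hl
  have hd := det_two (wMat p l)
  suffices hone : wMat p l = 1 by
    refine ⟨a + b, ?_⟩
    have : word (iota p) (gam p) l = 1 := Subtype.ext (by rw [coe_word, hone]; simp)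
    rw [this, mul_one, pow_add]
  obtain ⟨h00, h01, h10, h11⟩ := hW
  rcases commute_toPSL hw' with h | h
  · have e0 : (wMat p l * matS) 0 0 = (matS * wMat p l) 0 0 := by rw [h]
    have e1 : (wMat p l * matS) 0 1 = (matS * wMat p l) 0 1 := by rw [h]
    simp [mul_apply_two] at e0 e1
    have f01 : wMat p l 0 1 = 0 := by linarith
    have f10 : wMat p l 1 0 = 0 := by linarith
    rw [f01, ← e1] at hd
    have f00 : wMat p l 0 0 = 1 := by nlinarith
    apply ext_two <;> simp [f00, f01, f10, ← e1]
  · have e1 : (wMat p l * matS) 0 1 = (-(matS * wMat p l)) 0 1 := by rw [h]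
    rw [neg_apply_two] at e1
    simp [mul_apply_two] at e1
    linarith

end Involutions

section Even

variable {p m : ℕ}

theorem two_le_half (hp : 3 ≤ p) (hm : p = 2 * m) : 2 ≤ m := by omega

theorem one_le_sinRatio_half (hp : 3 ≤ p) (hm : p = 2 * m) : 1 ≤ sinRatio p m :=
  one_le_sinRatio hp (by omega) (by omega)

theorem sinRatio_half_add (hp : 3 ≤ p) (hm : p = 2 * m) :
    sinRatio p (m + 1) = sinRatio p (m - 1) := by
  rw [← sinRatio_sub hp]
  congr 1
  rw [hm]; push_cast; ring

theorem sinRatio_half_sub_pos (hp : 3 ≤ p) (hm : p = 2 * m) : 0 < sinRatio p (m - 1) := by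
  have := one_le_sinRatio hp (k := m - 1) (by omega) (by omega)
  rw [Nat.cast_pred (by omega)] at this
  linarith

theorem sinRatio_half_sub_lt (hp : 3 ≤ p) (hm : p = 2 * m) :
    sinRatio p (m - 1) < sinRatio p m := by
  have : (p : ℝ) = 2 * m := by rw [hm]; push_cast; ring
  have : (2 : ℝ) ≤ m := by exact_mod_cast two_le_half hp hm
  exact sinRatio_lt hp (by linarith) (by linarith) (by linarith)

theorem sinRatio_half_sub (hp : 3 ≤ p) (hm : p = 2 * m) :
    sinRatio p (m - 1) = Real.cos (Real.pi / p) * sinRatio p m := by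
  have h := sinRatio_add_one (p := p) m
  rw [sinRatio_half_add hp hm, lam] at h
  linarith

/-- The entries of the lift of `ι γ_p ^ m`, `p = 2 m`, are `[r, q; q, r]`. -/
theorem uMat_half (hp : 3 ≤ p) (hm : p = 2 * m) :
    uMat p m 0 0 = sinRatio p m ∧ uMat p m 0 1 = sinRatio p (m - 1) ∧
    uMat p m 1 0 = sinRatio p (m - 1) ∧ uMat p m 1 1 = sinRatio p m :=
  ⟨uMat_00 hp m, by rw [uMat_01 hp, sinRatio_half_add hp hm], uMat_10 hp m, uMat_11 hp m⟩

theorem rotation_half (hp : 3 ≤ p) (hm : p = 2 * m) :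
    ((matS * matT p) ^ m) 0 0 = -sinRatio p (m - 1) ∧
    ((matS * matT p) ^ m) 0 1 = -sinRatio p m ∧
    ((matS * matT p) ^ m) 1 0 = sinRatio p m ∧
    ((matS * matT p) ^ m) 1 1 = sinRatio p (m - 1) := by
  have := rotation_pow_entries hp m
  rwa [sinRatio_half_add hp hm] at this

/-- `γ_p ^ m` has negative upper row and positive lower row, so for reasons of sign it does not
commute with a positive matrix times `matS`. -/
theorem not_commute_word_mul_iota (hp : 3 ≤ p) (hm : p = 2 * m) {l : List ℕ}
    (hl : Letters p l) : ¬ Commute (word (iota p) (gam p) l * iota p) (gam p ^ m) := by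
  intro hc
  have hc' : Commute (toPSL (wMat p l * matS)) (toPSL ((matS * matT p) ^ m)) := by
    rw [map_mul, ← coe_word, ← gam_pow_coe, ← coe_iota]
    exact congrArg Subtype.val hc.eq
  obtain ⟨j00, j01, j10, j11⟩ := rotation_half hp hm
  obtain ⟨h00, h01, h10, h11⟩ := isPositive_wMat hp hl
  have hd := det_two (wMat p l)
  have hr := one_le_sinRatio_half hp hm
  have hq := sinRatio_half_sub_pos hp hm
  have hqr := sinRatio_half_sub_lt hp hm
  set r := sinRatio p m
  set q := sinRatio p (m - 1)
  set J := (matS * matT p) ^ m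
  rcases commute_toPSL hc' with h | h
  · have e0 : (wMat p l * matS * J) 0 0 = (J * (wMat p l * matS)) 0 0 := by rw [h]
    have e1 : (wMat p l * matS * J) 0 1 = (J * (wMat p l * matS)) 0 1 := by rw [h]
    simp [mul_apply_two, j00, j01, j10, j11] at e0 e1
    nlinarith [mul_pos hq (zero_lt_one.trans_le h00), mul_nonneg (zero_le_one.trans hr) h01,
      mul_nonneg (zero_le_one.trans hr) h10, mul_pos hq (zero_lt_one.trans_le h11)]
  · -- anticommuting lifts would generate a quaternion algebra inside `M₂(ℝ)`
    have e0 : (wMat p l * matS * J) 0 0 = (-(J * (wMat p l * matS))) 0 0 := by rw [h]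
    have e1 : (wMat p l * matS * J) 1 1 = (-(J * (wMat p l * matS))) 1 1 := by rw [h]
    rw [neg_apply_two] at e0 e1
    simp [mul_apply_two, j00, j01, j10, j11] at e0 e1
    set A := wMat p l 0 0
    set B := wMat p l 0 1
    set C := wMat p l 1 0
    set D := wMat p l 1 1
    have f1 : B = C := by
      have : q * (B - C) = 0 := by linarith
      have := (mul_eq_zero.1 this).resolve_left hq.ne'
      linarith
    nlinarith [mul_nonneg (zero_le_one.trans hr) h01,
      mul_nonneg hq.le h01, mul_nonneg hq.le h10]

/-- The stabilizer in `Γ_p` of the fixed point of `γ_p` is generated by `γ_p`. -/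
theorem exists_eq_gam_pow_of_commute (hp : 3 ≤ p) (hm : p = 2 * m) {z : heckeGroup p}
    (hz : Commute z (gam p ^ m)) : ∃ k : ℤ, z = gam p ^ k := by
  have hg : ∀ k : ℕ, Commute (gam p ^ k) (gam p ^ m) := fun k => Commute.pow_pow_self _ _ _
  have hii := iota_mul_self p
  have main : ∀ l, Letters p l → ∀ b : ℕ, b < 2 →
      Commute (word (iota p) (gam p) l * iota p ^ b) (gam p ^ m) →
      ∃ k : ℤ, word (iota p) (gam p) l * iota p ^ b = gam p ^ k := by
    intro l hl b hb hc
    interval_cases b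
    · rcases List.eq_nil_or_concat l with rfl | ⟨l, k, rfl⟩
      · exact ⟨0, by simp⟩
      · exfalso
        rw [List.concat_eq_append] at hl hc
        refine not_commute_word_mul_iota hp hm (letters_append.1 hl).1 ?_
        have := hc.mul_left (hg k).inv_left
        rwa [show word (iota p) (gam p) (l ++ [k]) * iota p ^ 0 * (gam p ^ k)⁻¹ =
          word (iota p) (gam p) l * iota p by
            rw [word_append, word_cons, word_nil]; group] at this
    · rw [pow_one] at hc
      exact absurd hc (not_commute_word_mul_iota hp hm hl)
  -- powers of `γ_p` at either end of `z` can be dropped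
  obtain ⟨l, hl, a, b, ha, hb, rfl⟩ := isNormalForm hp z
  interval_cases a
  · rw [pow_zero, one_mul] at hz ⊢
    exact main l hl b hb hz
  · rw [pow_one] at hz ⊢
    cases l with
    | nil =>
      interval_cases b
      · have := not_commute_word_mul_iota hp hm (letters_nil p)
        simp at this hz
        exact absurd hz this
      · exact ⟨0, by simp [hii]⟩
    | cons k l =>
      have e : iota p * word (iota p) (gam p) (k :: l) * iota p ^ b =
          gam p ^ k * (word (iota p) (gam p) l * iota p ^ b) := by
        rw [word_cons]; simp only [← mul_assoc, hii, one_mul]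
      rw [e] at hz ⊢
      have hz' : Commute (word (iota p) (gam p) l * iota p ^ b) (gam p ^ m) := by
        have := (hg k).inv_left.mul_left hz
        rwa [inv_mul_cancel_left] at this
      obtain ⟨j, hj⟩ := main l (letters_cons.1 hl).2 b hb hz'
      exact ⟨k + j, by rw [hj, zpow_add, zpow_natCast]⟩

/-! ### Elements with a fixed point at `1` or `-1` -/

/-- A word fixing `1` is a power of `ι γ_p ^ m`: the images of `[0, ∞]` under the letters are
separated, and only `ι γ_p ^ m` has `1` in the interior of its image. -/
theorem eq_half_of_word_fixes_one (hp : 3 ≤ p) (hm : p = 2 * m) {l : List ℕ}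
    (hl : Letters p l) (h : wMat p l 0 0 + wMat p l 0 1 = wMat p l 1 0 + wMat p l 1 1) :
    ∀ k ∈ l, k = m := by
  induction l with
  | nil => simp
  | cons k l ih =>
    obtain ⟨⟨h0, hk⟩, hl⟩ := letters_cons.1 hl
    obtain ⟨h00, h01, h10, h11⟩ := isPositive_wMat hp hl
    rw [wMat_cons] at h
    simp only [mul_apply_two, uMat_00 hp, uMat_01 hp, uMat_10 hp, uMat_11 hp] at h
    have hpm : (p : ℝ) = 2 * m := by rw [hm]; push_cast; ring
    have hkp : (k : ℝ) + 1 ≤ p := by exact_mod_cast hk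
    have hk0 : (1 : ℝ) ≤ k := by exact_mod_cast h0
    have hkm : k = m := by
      rcases lt_trichotomy k m with hlt | heq | hgt
      · exfalso
        have hlt' : (k : ℝ) + 1 ≤ m := by exact_mod_cast hlt
        have s1 := sinRatio_lt hp (x := k - 1) (y := k) (by linarith) (by linarith) (by linarith)
        have s2 := sinRatio_lt hp (x := k) (y := k + 1) (by linarith) (by linarith) (by linarith)
        nlinarith [mul_pos (sub_pos.2 s1) (show 0 < wMat p l 0 0 + wMat p l 0 1 by linarith),
          mul_pos (sub_pos.2 s2) (show 0 < wMat p l 1 0 + wMat p l 1 1 by linarith)]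
      · exact heq
      · exfalso
        have hgt' : (m : ℝ) + 1 ≤ k := by exact_mod_cast hgt
        have s1 := sinRatio_gt hp (x := k - 1) (y := k) (by linarith) (by linarith) (by linarith)
        have s2 := sinRatio_gt hp (x := k) (y := k + 1) (by linarith) (by linarith) (by linarith)
        nlinarith [mul_pos (sub_pos.2 s1) (show 0 < wMat p l 0 0 + wMat p l 0 1 by linarith),
          mul_pos (sub_pos.2 s2) (show 0 < wMat p l 1 0 + wMat p l 1 1 by linarith)]
    subst hkm
    refine List.forall_mem_cons.2 ⟨rfl, ih hl ?_⟩
    rw [sinRatio_half_add hp hm] at h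
    have hqr := sinRatio_half_sub_lt hp hm
    have : (sinRatio p k - sinRatio p (k - 1)) *
        (wMat p l 0 0 + wMat p l 0 1 - (wMat p l 1 0 + wMat p l 1 1)) = 0 := by linarith
    have := (mul_eq_zero.1 this).resolve_left (by linarith)
    linarith

theorem word_eq_pow {G : Type*} [Group G] {s c : G} {l : List ℕ} (h : ∀ k ∈ l, k = m) :
    word s c l = (s * c ^ m) ^ l.length := by
  rw [List.eq_replicate_of_mem h]
  simp [word]

theorem gam_half_mul_self (hp : 3 ≤ p) (hm : p = 2 * m) : gam p ^ m * gam p ^ m = 1 := by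
  rw [← pow_add, ← two_mul, ← hm, gam_pow_self hp]

/-- Two involutions generate a dihedral group. -/
theorem involution_conj_zpow {G : Type*} [Group G] {s w : G} (hs : s * s = 1) (hw : w * w = 1) (k : ℤ) :
    s * (s * w) ^ k * s⁻¹ = ((s * w) ^ k)⁻¹ ∧ w * (s * w) ^ k * w⁻¹ = ((s * w) ^ k)⁻¹ := by
  have hs' : s⁻¹ = s := inv_eq_of_mul_eq_one_left hs
  have hw' : w⁻¹ = w := inv_eq_of_mul_eq_one_left hw
  have e1 : s * (s * w) * s⁻¹ = (s * w)⁻¹ := by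
    rw [mul_inv_rev, ← mul_assoc, hs, one_mul, hw']
  have e2 : w * (s * w) * w⁻¹ = (s * w)⁻¹ := by
    rw [mul_inv_rev, mul_assoc, mul_assoc, mul_inv_cancel, mul_one, hw', hs']
  constructor
  · rw [← conj_zpow, e1, inv_zpow]
  · rw [← conj_zpow, e2, inv_zpow]

/-- The elements commuting with `ι γ_p ^ m` are those fixing `1` and `-1`. -/
theorem commute_half_iff_entries (hp : 3 ≤ p) (hm : p = 2 * m) {x : heckeGroup p} {X : SL(2, ℝ)}
    (hX : toPSL X = x) :
    Commute x (iota p * gam p ^ m) ↔ X 0 0 = X 1 1 ∧ X 0 1 = X 1 0 := by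
  obtain ⟨u00, u01, u10, u11⟩ := uMat_half hp hm
  have hr := one_le_sinRatio_half hp hm
  have hq := sinRatio_half_sub_pos hp hm
  constructor
  · intro h
    have h' : Commute (toPSL X) (toPSL (uMat p m)) := by
      rw [hX, ← coe_iota_mul_gam_pow]; exact congrArg Subtype.val h.eq
    have hc := commute_toPSL_of_trace (by rw [u00, u11]; linarith) h'
    have e0 : (X * uMat p m) 0 0 = (uMat p m * X) 0 0 := by rw [hc]
    have e1 : (X * uMat p m) 0 1 = (uMat p m * X) 0 1 := by rw [hc]
    simp only [mul_apply_two, u00, u01, u10, u11] at e0 e1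
    constructor
    · have : sinRatio p (m - 1) * (X 0 0 - X 1 1) = 0 := by linarith
      have := (mul_eq_zero.1 this).resolve_left hq.ne'
      linarith
    · have : sinRatio p (m - 1) * (X 0 1 - X 1 0) = 0 := by linarith
      have := (mul_eq_zero.1 this).resolve_left hq.ne'
      linarith
  · rintro ⟨h1, h2⟩
    apply Subtype.ext
    show (x : PSL2R) * (iota p * gam p ^ m : heckeGroup p) =
      (iota p * gam p ^ m : heckeGroup p) * (x : PSL2R)
    rw [← hX, coe_iota_mul_gam_pow, ← map_mul, ← map_mul]
    congr 1
    apply ext_two <;> simp only [mul_apply_two, u00, u01, u10, u11, h1, h2] <;> ring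

theorem exists_eq_zpow_of_commute (hp : 3 ≤ p) (hm : p = 2 * m) {x : heckeGroup p}
    (h : Commute x (iota p * gam p ^ m)) : ∃ k : ℤ, x = (iota p * gam p ^ m) ^ k := by
  obtain ⟨l, hl, a, b, ha, hb, hx⟩ := isNormalForm hp x
  have hX : toPSL (matS ^ a * wMat p l * matS ^ b) = x := by rw [hx, coe_normalForm]
  obtain ⟨e1, e2⟩ := (commute_half_iff_entries hp hm hX).1 h
  obtain ⟨h00, h01, h10, h11⟩ := isPositive_wMat hp hl
  interval_cases a <;> interval_cases b <;> simp [mul_apply_two] at e1 e2 hx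
  · have := eq_half_of_word_fixes_one hp hm hl (by linarith)
    exact ⟨l.length, by rw [hx, word_eq_pow this, zpow_natCast]⟩
  · linarith
  · linarith
  · have := eq_half_of_word_fixes_one hp hm hl (by linarith)
    refine ⟨-l.length, ?_⟩
    have hi : (iota p)⁻¹ = iota p := inv_eq_of_mul_eq_one_left (iota_mul_self p)
    have := (involution_conj_zpow (iota_mul_self p) (gam_half_mul_self hp hm) l.length).1
    rw [hx, word_eq_pow (by assumption), zpow_neg, ← this, zpow_natCast, hi]

/-- Conjugation by the powers of `ι γ_p ^ m`, which fixes `1` and `-1`, contracts the part of `X`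
that moves `1`. -/
theorem conj_uMat_pow (hp : 3 ≤ p) (hm : p = 2 * m) {X : SL(2, ℝ)}
    (h : X 0 0 - X 1 1 = X 0 1 - X 1 0) (n : ℕ) :
    let κ := (sinRatio p m - sinRatio p (m - 1)) ^ 2
    let δ := (X 0 0 - X 1 1) / 2
    let Y := uMat p m ^ n * X * (uMat p m ^ n)⁻¹
    Y 0 0 = X 0 0 - δ + κ ^ n * δ ∧ Y 0 1 = X 0 1 - δ + κ ^ n * δ ∧
    Y 1 0 = X 1 0 + δ - κ ^ n * δ ∧ Y 1 1 = X 1 1 + δ - κ ^ n * δ := by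
  intro κ δ Y
  obtain ⟨u00, u01, u10, u11⟩ := uMat_half hp hm
  have hd := det_two (uMat p m)
  rw [u00, u01, u10, u11] at hd
  induction n with
  | zero => simp [Y]
  | succ n ih =>
    obtain ⟨i00, i01, i10, i11⟩ := ih
    have e : Y = uMat p m * (uMat p m ^ n * X * (uMat p m ^ n)⁻¹) * (uMat p m)⁻¹ := by
      simp only [Y, pow_succ']; group
    set Z := uMat p m ^ n * X * (uMat p m ^ n)⁻¹
    rw [e]
    simp only [mul_apply_two, inv_apply_00, inv_apply_01, inv_apply_10, inv_apply_11,
      u00, u01, u10, u11, i00, i01, i10, i11, pow_succ κ n]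
    have hδ : X 0 0 - X 1 1 = 2 * δ := by simp only [δ]; ring
    have hδ' : X 0 1 - X 1 0 = 2 * δ := by rw [← h, hδ]
    have hκ : κ = (sinRatio p m - sinRatio p (m - 1)) ^ 2 := rfl
    set r := sinRatio p m
    set q := sinRatio p (m - 1)
    have x11 : X 1 1 = X 0 0 - 2 * δ := by linarith
    have x10 : X 1 0 = X 0 1 - 2 * δ := by linarith
    rw [x11, x10, hκ]
    refine ⟨?_, ?_, ?_, ?_⟩
    · linear_combination (X 0 0 - δ) * hd
    · linear_combination (X 0 1 - δ) * hd
    · linear_combination (X 0 1 - δ) * hd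
    · linear_combination (X 0 0 - δ) * hd

/-- An element of `Γ_p`, `p = 2 m`, that fixes `-1` also fixes `1`: otherwise its conjugates by the
powers of `ι γ_p ^ m` would accumulate. -/
theorem diag_eq_of_fixes_neg_one (hp : 3 ≤ p) (hm : p = 2 * m) {x : heckeGroup p} {X : SL(2, ℝ)}
    (hX : toPSL X = x) (h : X 0 0 - X 1 1 = X 0 1 - X 1 0) : X 0 0 = X 1 1 := by
  by_contra hne
  have hconj := conj_uMat_pow hp hm h
  have hr := one_le_sinRatio_half hp hm
  have hq := sinRatio_half_sub_pos hp hm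
  have hqr := sinRatio_half_sub_lt hp hm
  have hd := det_two (uMat p m)
  obtain ⟨u00, u01, u10, u11⟩ := uMat_half hp hm
  rw [u00, u01, u10, u11] at hd
  set κ := (sinRatio p m - sinRatio p (m - 1)) ^ 2 with hκ
  set δ := (X 0 0 - X 1 1) / 2 with hδ
  have hκ0 : 0 < κ := pow_pos (by linarith) 2
  have hκ1 : κ < 1 := by nlinarith
  have hδ0 : δ ≠ 0 := by
    intro h0; apply hne; linarith
  set u := iota p * gam p ^ m
  let f : ℕ → heckeGroup p := fun n => u ^ n * x * (u ^ n)⁻¹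
  have hf : ∀ n, toPSL (uMat p m ^ n * X * (uMat p m ^ n)⁻¹) = f n := by
    intro n
    rw [map_mul, map_mul, map_inv, map_pow, ← coe_iota_mul_gam_pow, hX]
    rfl
  have hinj : Function.Injective f := by
    intro n k hnk
    have e : toPSL (uMat p m ^ n * X * (uMat p m ^ n)⁻¹) =
        toPSL (uMat p m ^ k * X * (uMat p m ^ k)⁻¹) := by
      rw [hf, hf, hnk]
    obtain ⟨n00, n01, n10, n11⟩ := hconj n
    obtain ⟨k00, k01, k10, k11⟩ := hconj k
    rcases toPSL_eq_iff.1 e with e | e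
    · rw [e, n00] at k00
      have : κ ^ n = κ ^ k := mul_right_cancel₀ hδ0 (by linarith)
      exact pow_right_injective₀ hκ0 hκ1.ne this
    · -- lifts of opposite sign would force the trace to vanish and the determinant to be `0`
      exfalso
      rw [e, neg_apply_two] at k00 k01 k10 k11
      have hdX := det_two X
      have x11 : X 1 1 = -X 0 0 := by linarith
      have x01 : X 0 1 = X 0 0 := by linarith
      have x10 : X 1 0 = -X 0 0 := by linarith
      rw [x11, x01, x10] at hdX
      linarith
  have hfin := finite_bounded hp (|X 0 0| + |X 0 1| + |X 1 0| + |X 1 1| + 2 * |δ|)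
  refine Set.infinite_of_injective_forall_mem hinj (fun n => ?_) hfin
  refine ⟨_, hf n, ?_⟩
  obtain ⟨n00, n01, n10, n11⟩ := hconj n
  have hκn : 0 ≤ κ ^ n := (pow_pos hκ0 n).le
  have hκn1 : κ ^ n ≤ 1 := pow_le_one₀ hκ0.le hκ1.le
  have hb : |κ ^ n * δ - δ| ≤ 2 * |δ| := by
    have : κ ^ n * δ - δ = -((1 - κ ^ n) * δ) := by ring
    rw [this, abs_neg, abs_mul, abs_of_nonneg (by linarith)]
    nlinarith [abs_nonneg δ]
  have hA := abs_apply_le_sum X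
  have a00 := hA 0 0
  have a01 := hA 0 1
  have a10 := hA 1 0
  have a11 := hA 1 1
  intro i j
  fin_cases i <;> fin_cases j <;> simp only [Fin.zero_eta, Fin.mk_one]
  · rw [n00]; rw [abs_le] at *; constructor <;> linarith
  · rw [n01]; rw [abs_le] at *; constructor <;> linarith
  · rw [n10]; rw [abs_le] at *; constructor <;> linarith
  · rw [n11]; rw [abs_le] at *; constructor <;> linarith

end Even

/-! ### Symmetric and `p`-reciprocal elements through their reciprocators -/

section Characterization

variable {p m : ℕ}

theorem isSymmetric_toPSL (M : SL(2, ℝ)) : IsSymmetric (toPSL M) ↔ M 0 1 = M 1 0 := by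
  have key : ∀ N : SL(2, ℝ), (N : Matrix (Fin 2) (Fin 2) ℝ).IsSymm ↔ N 0 1 = N 1 0 := by
    intro N
    rw [Matrix.IsSymm.ext_iff]
    simp only [Fin.forall_fin_two]
    constructor
    · exact fun h => h.2.1
    · exact fun h => ⟨⟨trivial, h.symm⟩, h, trivial⟩
  constructor
  · rintro ⟨N, hN, h⟩
    rw [key] at h
    rcases toPSL_eq_iff.1 hN with rfl | rfl
    · exact h
    · rw [neg_apply_two, neg_apply_two, h]
  · exact fun h => ⟨M, rfl, (key M).2 h⟩

theorem isSymmetric_iff {g : heckeGroup p} (hg : IsHyperbolic (g : PSL2R)) :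
    IsSymmetric (g : PSL2R) ↔ IsReciprocator (iota p) g := by
  obtain ⟨M, hM⟩ := exists_lift (g : PSL2R)
  rw [isReciprocator_coe, ← hM]
  rw [← hM, isHyperbolic_toPSL] at hg
  rw [isSymmetric_toPSL, coe_iota, isReciprocator_toPSL hg]
  simp
  constructor <;> intro h <;> linarith

/-- The lift of `γ_p ^ m` is proportional to `[-cos (π / p), -1; 1, cos (π / p)]`. -/
theorem isReciprocator_gam_half (hp : 3 ≤ p) (hm : p = 2 * m) {g : heckeGroup p}
    (hg : IsHyperbolic (g : PSL2R)) {M : SL(2, ℝ)} (hM : toPSL M = g) :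
    IsReciprocator (gam p ^ m) g ↔
      M 0 1 - M 1 0 = Real.cos (Real.pi / p) * (M 0 0 - M 1 1) := by
  rw [isReciprocator_coe, ← hM]
  rw [← hM, isHyperbolic_toPSL] at hg
  rw [gam_pow_coe, isReciprocator_toPSL hg]
  obtain ⟨h1, h2, h3, h4⟩ := rotation_half hp hm
  have hr := one_le_sinRatio_half hp hm
  rw [h1, h2, h3, h4, sinRatio_half_sub hp hm]
  constructor
  · rintro ⟨-, h⟩
    have : sinRatio p m * (M 0 1 - M 1 0 - Real.cos (Real.pi / p) * (M 0 0 - M 1 1)) = 0 := by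
      linarith
    have := (mul_eq_zero.1 this).resolve_left (by linarith)
    linarith
  · intro h
    exact ⟨by ring, by linear_combination sinRatio p m * h⟩

theorem ratio_toPSL (M : SL(2, ℝ)) : ratio (toPSL M) = matRatio M := rfl

theorem matRatio_eq_coe_iff (M : SL(2, ℝ)) (c : ℝ) :
    matRatio M = (c : OnePoint ℝ) ↔
      (M 0 0 ≠ M 1 1 ∧ M 0 1 - M 1 0 = c * (M 0 0 - M 1 1)) ∨
        (M 0 0 = M 1 1 ∧ M 0 1 = M 1 0 ∧ c = 1) := by
  unfold matRatio
  by_cases h : M 0 0 = M 1 1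
  · by_cases h' : M 0 1 = M 1 0
    · simp [h, h', eq_comm]
    · simp [h, h']
  · rw [if_pos h, OnePoint.coe_eq_coe, div_eq_iff (sub_ne_zero.2 h)]
    simp [h]

/-- For even `p`, the ratio of an element of `Γ_p` is `1` only if the element fixes `1` and `-1`. -/
theorem ratio_eq_one_iff (hp : 3 ≤ p) (hm : p = 2 * m) {g : heckeGroup p} {M : SL(2, ℝ)}
    (hM : toPSL M = g) :
    ratio (g : PSL2R) = ((1 : ℝ) : OnePoint ℝ) ↔ M 0 0 = M 1 1 ∧ M 0 1 = M 1 0 := by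
  rw [← hM, ratio_toPSL, matRatio_eq_coe_iff]
  constructor
  · rintro (⟨h1, h2⟩ | ⟨h1, h2, -⟩)
    · exact absurd (diag_eq_of_fixes_neg_one hp hm hM (by linarith)) h1
    · exact ⟨h1, h2⟩
  · exact fun h => .inr ⟨h.1, h.2, rfl⟩

/-- If `a = d`, the condition for `γ_p ^ m` reads `b = c`: this is the case `θ_g = 1`. -/
theorem isPReciprocal_iff (hp : 3 ≤ p) (hm : p = 2 * m) {g : heckeGroup p}
    (hg : IsHyperbolic (g : PSL2R)) (hr : IsReciprocal g) :
    IsPReciprocal p g ↔ IsReciprocator (gam p ^ m) g := by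
  obtain ⟨M, hM⟩ := exists_lift (g : PSL2R)
  unfold IsPReciprocal
  rw [isReciprocator_gam_half hp hm hg hM, ratio_eq_one_iff hp hm hM, ← hM, ratio_toPSL,
    matRatio_eq_coe_iff]
  constructor
  · rintro ⟨-, -, (⟨-, h⟩ | ⟨h1, h2, -⟩) | ⟨h1, h2⟩⟩
    · exact h
    · rw [h1, h2]; ring
    · rw [h1, h2]; ring
  · intro h
    refine ⟨by rwa [hM], hr, ?_⟩
    by_cases h1 : M 0 0 = M 1 1
    · rw [h1, sub_self, mul_zero, sub_eq_zero] at h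
      exact .inr ⟨h1, h⟩
    · exact .inl (.inl ⟨h1, h⟩)

theorem isSymmetricPReciprocal_iff (hp : 3 ≤ p) (hm : p = 2 * m) {g : heckeGroup p}
    (hg : IsHyperbolic (g : PSL2R)) (hr : IsReciprocal g) :
    IsSymmetricPReciprocal p g ↔
      IsReciprocator (iota p) g ∧ IsReciprocator (gam p ^ m) g := by
  obtain ⟨M, hM⟩ := exists_lift (g : PSL2R)
  unfold IsSymmetricPReciprocal
  rw [isReciprocator_gam_half hp hm hg hM, ratio_eq_one_iff hp hm hM, ← isSymmetric_iff hg, ← hM,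
    isSymmetric_toPSL]
  have hc := cos_angle_pos hp
  constructor
  · rintro ⟨-, -, h1, h2⟩
    exact ⟨h2, by rw [h1, h2]; ring⟩
  · rintro ⟨h1, h2⟩
    refine ⟨by rwa [hM], hr, ?_, h1⟩
    rw [h1, sub_self, eq_comm, mul_eq_zero] at h2
    linarith [h2.resolve_left hc.ne']

theorem commute_half_of_isReciprocator {g : heckeGroup p}
    (h1 : IsReciprocator (iota p) g) (h2 : IsReciprocator (gam p ^ m) g) :
    Commute g (iota p * gam p ^ m) := by
  unfold IsReciprocator at *
  have h1' : iota p * g⁻¹ * (iota p)⁻¹ = g := by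
    have := congrArg (·⁻¹) h1
    simpa [mul_assoc] using this
  have : iota p * gam p ^ m * g * (iota p * gam p ^ m)⁻¹ = g := by
    calc _ = iota p * (gam p ^ m * g * (gam p ^ m)⁻¹) * (iota p)⁻¹ := by group
      _ = g := by rw [h2, h1']
  exact (mul_inv_eq_iff_eq_mul.1 this).symm

end Characterization

/-! ### Counting in `Γ_p` -/

section Counting

variable {p m : ℕ}

theorem centralizer_eq_zpowers {G : Type*} [Group G] {s c : G} (hc : Commute c s)
    (h : ∀ z, Commute z s → ∃ k : ℤ, z = c ^ k) :
    Subgroup.centralizer {s} = Subgroup.zpowers c := by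
  ext z
  rw [Subgroup.mem_centralizer_singleton_iff, Subgroup.mem_zpowers_iff]
  constructor
  · intro hz
    obtain ⟨k, hk⟩ := h z hz
    exact ⟨k, hk.symm⟩
  · rintro ⟨k, rfl⟩
    exact (hc.zpow_left k).eq

theorem card_centralizer {G : Type*} [Group G] {s c : G} {n : ℕ} (hn : orderOf c = n)
    (hn0 : n ≠ 0) (hc : Commute c s) (h : ∀ z, Commute z s → ∃ k : ℤ, z = c ^ k) :
    ENat.card (Subgroup.centralizer {s}) = n := by
  rw [centralizer_eq_zpowers hc h]
  have : Finite (Subgroup.zpowers c) :=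
    (isOfFinOrder_iff_pow_eq_one.2 ⟨n, Nat.pos_of_ne_zero hn0, hn ▸ pow_orderOf_eq_one c⟩
      |>.finite_zpowers)
  rw [ENat.card_eq_coe_natCard, Nat.card_zpowers, hn]

/-- The centralizers of `s` and of a conjugate of `r` meet trivially if the first is finite cyclic,
as the second is torsion-free. -/
theorem DihedralData.eq_one_of_commute {G : Type*} [Group G] {r t h s c : G}
    (D : DihedralData r t h) {n : ℕ} (hn : orderOf c = n) (hn0 : n ≠ 0)
    (hs : ∀ z, Commute z s → ∃ k : ℤ, z = c ^ k) :
    ∀ g ∈ conjugatesOf r, ∀ z, Commute z s → Commute z g → z = 1 := by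
  intro g hg z hz hzg
  obtain ⟨x, rfl⟩ := isConj_iff.1 hg
  obtain ⟨k, hk⟩ := hs z hz
  have hzn : z ^ n = 1 := by
    rw [hk, ← zpow_natCast, ← zpow_mul, mul_comm, zpow_mul, zpow_natCast, ← hn,
      pow_orderOf_eq_one, one_zpow]
  obtain ⟨j, hj⟩ := D.cyclic (x⁻¹ * z * x) (by
    show x⁻¹ * z * x * r = r * (x⁻¹ * z * x)
    calc x⁻¹ * z * x * r = x⁻¹ * (z * (x * r * x⁻¹)) * x := by group
      _ = _ := by rw [hzg.eq]; group)
  have h1 : t ^ (j * n) = 1 := by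
    have e : (x⁻¹ * z * x) ^ n = x⁻¹ * z ^ n * x := by
      have := conj_pow (a := x⁻¹) (b := z) (i := n)
      rwa [inv_inv] at this
    rw [zpow_mul, zpow_natCast, ← hj, e, hzn]; group
  have h2 := D.infinite _ h1
  have h3 : j = 0 := (mul_eq_zero.1 h2).resolve_right (by exact_mod_cast hn0)
  rw [h3, zpow_zero] at hj
  calc z = x * (x⁻¹ * z * x) * x⁻¹ := by group
    _ = 1 := by rw [hj]; group

theorem centralizer_iota (hp : 3 ≤ p) (z : heckeGroup p) (hz : Commute z (iota p)) :
    ∃ k : ℤ, z = iota p ^ k := by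
  obtain ⟨k, hk⟩ := exists_eq_iota_pow_of_commute hp hz
  exact ⟨k, by rw [hk, zpow_natCast]⟩

theorem card_centralizer_iota (hp : 3 ≤ p) :
    ENat.card (Subgroup.centralizer {iota p}) = 2 :=
  card_centralizer orderOf_iota two_ne_zero (Commute.refl _) (centralizer_iota hp)

theorem card_centralizer_gam (hp : 3 ≤ p) (hm : p = 2 * m) :
    ENat.card (Subgroup.centralizer {gam p ^ m}) = p :=
  card_centralizer (orderOf_gam hp) (by omega) (Commute.self_pow _ _)
    fun _ hz => exists_eq_gam_pow_of_commute hp hm hz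

/-- `γ_p` commutes with `γ_p ^ m` and has order `p > 2`, the order of the centralizer of `ι`. -/
theorem not_isConj_iota_gam (hp : 3 ≤ p) (m : ℕ) : ¬ IsConj (iota p) (gam p ^ m) := by
  intro h
  obtain ⟨x, hx⟩ := isConj_iff.1 h
  have hcm : gam p * gam p ^ m = gam p ^ m * gam p := (Commute.self_pow _ _).eq
  obtain ⟨k, hk⟩ := exists_eq_iota_pow_of_commute hp (z := x⁻¹ * gam p * x) (by
    show x⁻¹ * gam p * x * iota p = iota p * (x⁻¹ * gam p * x)
    calc x⁻¹ * gam p * x * iota p = x⁻¹ * (gam p * (x * iota p * x⁻¹)) * x := by group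
      _ = x⁻¹ * ((x * iota p * x⁻¹) * gam p) * x := by rw [hx, hcm]
      _ = _ := by group)
  have h2 : (x⁻¹ * gam p * x) ^ 2 = 1 := by
    rw [hk, ← pow_mul, mul_comm, pow_mul, pow_two, iota_mul_self, one_pow]
  have h3 : gam p ^ 2 = 1 := by
    have e := conj_pow (a := x⁻¹) (b := gam p) (i := 2)
    rw [inv_inv, h2] at e
    calc gam p ^ 2 = x * (x⁻¹ * gam p ^ 2 * x) * x⁻¹ := by group
      _ = 1 := by rw [← e]; group
  exact gam_pow_ne_one hp two_pos (by omega) h3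

theorem isConj_of_isReciprocator (hp : 3 ≤ p) {r g h : heckeGroup p}
    (hr : IsHyperbolic (r : PSL2R)) (hg : g ∈ conjugatesOf r) (hh : IsReciprocator h g) :
    IsConj h (iota p) ∨ ∃ m, p = 2 * m ∧ IsConj h (gam p ^ m) := by
  obtain ⟨H, hH⟩ := exists_lift (h : PSL2R)
  exact isConj_of_lift_trace hp hH (hh.lift_trace (isHyperbolic_of_mem_conjugatesOf hr hg) hH)

theorem isReciprocal_of_mem_conjugatesOf {G : Type*} [Group G] {r g : G} (hr : IsReciprocal r)
    (hg : g ∈ conjugatesOf r) : IsReciprocal g := by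
  obtain ⟨x, rfl⟩ := isConj_iff.1 hg
  obtain ⟨h, hh⟩ := hr
  exact ⟨_, hh.conj x⟩

/-- The conjugacy class of the reciprocators is constant along a conjugacy class. -/
theorem exists_isReciprocator_of_mem_conjugatesOf {G : Type*} [Group G] {r g g' s : G}
    (hg : g ∈ conjugatesOf r) (hg' : g' ∈ conjugatesOf r)
    (h : ∃ k, IsReciprocator k g ∧ IsConj k s) : ∃ k, IsReciprocator k g' ∧ IsConj k s := by
  obtain ⟨k, hk, hks⟩ := h
  obtain ⟨x, rfl⟩ := isConj_iff.1 ((show IsConj r g from hg).symm.trans hg')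
  exact ⟨_, hk.conj x, (isConj_iff.2 ⟨x, rfl⟩ : IsConj k _).symm.trans hks⟩

theorem pureType_or_mixedType {G : Type*} [Group G] {r s t : G}
    (h : ∀ g ∈ conjugatesOf r, ∀ h, IsReciprocator h g → IsConj h s ∨ IsConj h t) :
    PureType r s ∨ PureType r t ∨ MixedType r s t := by
  by_cases hs : PureType r s
  · exact .inl hs
  by_cases ht : PureType r t
  · exact .inr (.inl ht)
  unfold PureType at hs ht
  push Not at hs ht
  obtain ⟨g, hg, k, hk, hks⟩ := hs
  obtain ⟨g', hg', k', hk', hkt⟩ := ht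
  exact .inr (.inr fun x hx =>
    ⟨exists_isReciprocator_of_mem_conjugatesOf hg' hx
      ⟨k', hk', (h g' hg' k' hk').resolve_right hkt⟩,
    exists_isReciprocator_of_mem_conjugatesOf hg hx ⟨k, hk, (h g hg k hk).resolve_left hks⟩⟩)

theorem setOf_isSymmetric {r : heckeGroup p} (hr : IsHyperbolic (r : PSL2R)) :
    {g ∈ conjugatesOf r | IsSymmetric (g : PSL2R)} =
      {g ∈ conjugatesOf r | IsReciprocator (iota p) g} := by
  ext g
  exact and_congr_right fun hg => isSymmetric_iff (isHyperbolic_of_mem_conjugatesOf hr hg)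

theorem setOf_isPReciprocal (hp : 3 ≤ p) (hm : p = 2 * m) {r : heckeGroup p}
    (hr : IsHyperbolic (r : PSL2R)) (hrec : IsReciprocal r) :
    {g ∈ conjugatesOf r | IsPReciprocal p g} =
      {g ∈ conjugatesOf r | IsReciprocator (gam p ^ m) g} := by
  ext g
  exact and_congr_right fun hg => isPReciprocal_iff hp hm
    (isHyperbolic_of_mem_conjugatesOf hr hg) (isReciprocal_of_mem_conjugatesOf hrec hg)

theorem encard_symmetric_of_pureType (hp : 3 ≤ p) {r : heckeGroup p}
    (hr : IsHyperbolic (r : PSL2R)) (hrec : IsReciprocal r) (h : PureType r (iota p)) :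
    {g ∈ conjugatesOf r | IsSymmetric (g : PSL2R)}.encard = 4 := by
  obtain ⟨k, hk⟩ := hrec
  obtain ⟨t, D⟩ := exists_dihedralData hp hr hk
  rw [setOf_isSymmetric hr, D.encard_of_pureType h
    (D.eq_one_of_commute orderOf_iota two_ne_zero (centralizer_iota hp)),
    card_centralizer_iota hp]
  norm_num

theorem encard_pReciprocal_of_pureType (hp : 3 ≤ p) (hm : p = 2 * m) {r : heckeGroup p}
    (hr : IsHyperbolic (r : PSL2R)) (hrec : IsReciprocal r) (h : PureType r (gam p ^ m)) :
    {g ∈ conjugatesOf r | IsPReciprocal p g}.encard = ((2 * p : ℕ) : ℕ∞) := by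
  rw [setOf_isPReciprocal hp hm hr hrec]
  obtain ⟨k, hk⟩ := hrec
  obtain ⟨t, D⟩ := exists_dihedralData hp hr hk
  rw [D.encard_of_pureType h (D.eq_one_of_commute (orderOf_gam hp) (by omega)
    fun _ hz => exists_eq_gam_pow_of_commute hp hm hz), card_centralizer_gam hp hm]
  norm_num

theorem encard_of_mixedType (hp : 3 ≤ p) (hm : p = 2 * m) {r : heckeGroup p}
    (hr : IsHyperbolic (r : PSL2R)) (hrec : IsReciprocal r)
    (h : MixedType r (iota p) (gam p ^ m)) :
    {g ∈ conjugatesOf r | IsReciprocator (iota p) g}.encard = 2 ∧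
      {g ∈ conjugatesOf r | IsReciprocator (gam p ^ m) g}.encard = p := by
  obtain ⟨k, hk⟩ := hrec
  obtain ⟨t, D⟩ := exists_dihedralData hp hr hk
  obtain ⟨h1, h2⟩ := h r (IsConj.refl r)
  have hne := not_isConj_iota_gam hp m
  constructor
  · rw [D.encard_of_mixedType hne h1 h2
      (D.eq_one_of_commute orderOf_iota two_ne_zero (centralizer_iota hp)),
      card_centralizer_iota hp]
  · rw [D.encard_of_mixedType (fun h => hne h.symm) h2 h1
      (D.eq_one_of_commute (orderOf_gam hp) (by omega)
        fun _ hz => exists_eq_gam_pow_of_commute hp hm hz), card_centralizer_gam hp hm]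

/-- In a class of mixed type meeting the powers of `ι γ_p ^ m`, the two symmetric elements are
such a power and its inverse, so they also have the reciprocator `γ_p ^ m`. -/
theorem isReciprocator_gam_of_mixedType (hp : 3 ≤ p) (hm : p = 2 * m) {r : heckeGroup p}
    (hr : IsHyperbolic (r : PSL2R)) (hrec : IsReciprocal r)
    (h : MixedType r (iota p) (gam p ^ m)) {k : ℤ}
    (hk : (iota p * gam p ^ m) ^ k ∈ conjugatesOf r) {g : heckeGroup p}
    (hg : g ∈ conjugatesOf r) (hgi : IsReciprocator (iota p) g) :
    IsReciprocator (gam p ^ m) g := by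
  have hcard := (encard_of_mixedType hp hm hr hrec h).1
  set A := {g ∈ conjugatesOf r | IsReciprocator (iota p) g}
  set g₀ := (iota p * gam p ^ m) ^ k with hg₀
  obtain ⟨h1, h2⟩ := involution_conj_zpow (iota_mul_self p) (gam_half_mul_self hp hm) k
  rw [← hg₀] at h1 h2
  have hinv : ∀ s : heckeGroup p, s * g₀ * s⁻¹ = g₀⁻¹ → s * g₀⁻¹ * s⁻¹ = (g₀⁻¹)⁻¹ := by
    intro s hs
    calc s * g₀⁻¹ * s⁻¹ = (s * g₀ * s⁻¹)⁻¹ := by group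
      _ = _ := by rw [hs]
  have hsub : ({g₀, g₀⁻¹} : Set (heckeGroup p)) ⊆ A := by
    rintro x (rfl | rfl)
    · exact ⟨hk, h1⟩
    · exact ⟨(show IsConj r g₀ from hk).trans (isConj_iff.2 ⟨_, h1⟩), hinv _ h1⟩
  have hne : g₀ ≠ g₀⁻¹ :=
    (inv_ne_self_of_isHyperbolic (isHyperbolic_of_mem_conjugatesOf hr hk)).symm
  have hfin : A.Finite := Set.finite_of_encard_eq_coe (k := 2) (by rw [hcard]; rfl)
  have heq := (hfin.subset hsub).eq_of_subset_of_encard_le hsub (by rw [hcard, Set.encard_pair hne])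
  have hgA : g ∈ A := ⟨hg, hgi⟩
  rw [← heq] at hgA
  rcases hgA with rfl | rfl
  · exact h2
  · exact hinv _ h2

end Counting

end Hecke

end

theorem theorem1p3 (p : ℕ) (hp : 3 ≤ p) (r : Hecke.heckeGroup p)
    (hyp : Hecke.IsHyperbolic (r : Hecke.PSL2R)) (hr : Hecke.IsReciprocal r) :
    (Odd p → {g ∈ conjugatesOf r | Hecke.IsSymmetric (g : Hecke.PSL2R)}.encard = 4) ∧
    (∀ m : ℕ, p = 2 * m →
      (∀ g ∈ conjugatesOf r, ∀ h : Hecke.heckeGroup p, Hecke.IsReciprocator h g →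
        IsConj h (Hecke.iota p) ∨ IsConj h (Hecke.gam p ^ m)) ∧
      (Hecke.PureType r (Hecke.iota p) ∨ Hecke.PureType r (Hecke.gam p ^ m) ∨
        Hecke.MixedType r (Hecke.iota p) (Hecke.gam p ^ m)) ∧
      (Hecke.PureType r (Hecke.iota p) →
        {g ∈ conjugatesOf r | Hecke.IsSymmetric (g : Hecke.PSL2R)}.encard = 4) ∧
      (Hecke.PureType r (Hecke.gam p ^ m) →
        {g ∈ conjugatesOf r | Hecke.IsPReciprocal p g}.encard = ((2 * p : ℕ) : ℕ∞)) ∧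
      (Hecke.MixedType r (Hecke.iota p) (Hecke.gam p ^ m) →
        ((¬ ∃ k : ℤ, k ≠ 0 ∧ (Hecke.iota p * Hecke.gam p ^ m) ^ k ∈ conjugatesOf r) →
          {g ∈ conjugatesOf r | Hecke.IsSymmetric (g : Hecke.PSL2R)}.encard = 2 ∧
          {g ∈ conjugatesOf r | Hecke.IsPReciprocal p g}.encard = (p : ℕ∞) ∧
          (∀ g ∈ conjugatesOf r,
            ¬ (Hecke.IsSymmetric (g : Hecke.PSL2R) ∧ Hecke.IsPReciprocal p g))) ∧
        ((∃ k : ℤ, k ≠ 0 ∧ (Hecke.iota p * Hecke.gam p ^ m) ^ k ∈ conjugatesOf r) →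
          {g ∈ conjugatesOf r | Hecke.IsSymmetricPReciprocal p g}.encard = 2 ∧
          (∀ g ∈ conjugatesOf r,
            Hecke.IsSymmetric (g : Hecke.PSL2R) → Hecke.IsSymmetricPReciprocal p g) ∧
          {g ∈ conjugatesOf r | Hecke.IsPReciprocal p g ∧
            ¬ Hecke.IsSymmetricPReciprocal p g}.encard = ((p - 2 : ℕ) : ℕ∞)))) := by
  open Hecke in
  have hdich : ∀ m : ℕ, p = 2 * m → ∀ g ∈ conjugatesOf r, ∀ h : heckeGroup p,
      IsReciprocator h g → IsConj h (iota p) ∨ IsConj h (gam p ^ m) := by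
    intro m hm g hg h hh
    rcases isConj_of_isReciprocator hp hyp hg hh with hc | ⟨m', hm', hc⟩
    · exact .inl hc
    · obtain rfl : m = m' := by omega
      exact .inr hc
  refine ⟨fun hodd => ?_, fun m hm => ⟨hdich m hm, Hecke.pureType_or_mixedType (hdich m hm),
    Hecke.encard_symmetric_of_pureType hp hyp hr,
    Hecke.encard_pReciprocal_of_pureType hp hm hyp hr, fun hmix => ⟨fun hno => ?_, ?_⟩⟩⟩
  · refine Hecke.encard_symmetric_of_pureType hp hyp hr fun g hg h hh => ?_
    refine (Hecke.isConj_of_isReciprocator hp hyp hg hh).resolve_right ?_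
    rintro ⟨m, hm, -⟩
    exact (Nat.not_even_iff_odd.2 hodd) ⟨m, by omega⟩
  · obtain ⟨hA, hB⟩ := Hecke.encard_of_mixedType hp hm hyp hr hmix
    rw [← Hecke.setOf_isSymmetric hyp] at hA
    rw [← Hecke.setOf_isPReciprocal hp hm hyp hr] at hB
    refine ⟨hA, hB, fun g hg ⟨hs, hpr⟩ => hno ?_⟩
    have hgh := Hecke.isHyperbolic_of_mem_conjugatesOf hyp hg
    rw [Hecke.isSymmetric_iff hgh] at hs
    rw [Hecke.isPReciprocal_iff hp hm hgh (Hecke.isReciprocal_of_mem_conjugatesOf hr hg)] at hpr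
    obtain ⟨k, hk⟩ := Hecke.exists_eq_zpow_of_commute hp hm
      (Hecke.commute_half_of_isReciprocator hs hpr)
    refine ⟨k, ?_, hk ▸ hg⟩
    rintro rfl
    rw [zpow_zero] at hk
    exact Hecke.inv_ne_self_of_isHyperbolic hgh (by rw [hk, inv_one])
  · rintro ⟨k, -, hk⟩
    obtain ⟨hA, hB⟩ := Hecke.encard_of_mixedType hp hm hyp hr hmix
    have hsub : ∀ g ∈ conjugatesOf r, Hecke.IsReciprocator (Hecke.iota p) g →
        Hecke.IsReciprocator (Hecke.gam p ^ m) g := fun g hg hgi =>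
      Hecke.isReciprocator_gam_of_mixedType hp hm hyp hr hmix hk hg hgi
    have hsymP : ∀ g ∈ conjugatesOf r,
        (Hecke.IsSymmetricPReciprocal p g ↔ Hecke.IsReciprocator (Hecke.iota p) g) := by
      intro g hg
      rw [Hecke.isSymmetricPReciprocal_iff hp hm (Hecke.isHyperbolic_of_mem_conjugatesOf hyp hg)
        (Hecke.isReciprocal_of_mem_conjugatesOf hr hg)]
      exact ⟨fun h => h.1, fun h => ⟨h, hsub g hg h⟩⟩
    have hA' : {g ∈ conjugatesOf r | Hecke.IsSymmetricPReciprocal p g} =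
        {g ∈ conjugatesOf r | Hecke.IsReciprocator (Hecke.iota p) g} := by
      ext g
      exact and_congr_right fun hg => hsymP g hg
    refine ⟨by rw [hA', hA], fun g hg hs => ?_, ?_⟩
    · rw [hsymP g hg, ← Hecke.isSymmetric_iff (Hecke.isHyperbolic_of_mem_conjugatesOf hyp hg)]
      exact hs
    · have hdiff : {g ∈ conjugatesOf r | Hecke.IsPReciprocal p g ∧
            ¬ Hecke.IsSymmetricPReciprocal p g} =
          {g ∈ conjugatesOf r | Hecke.IsReciprocator (Hecke.gam p ^ m) g} \
            {g ∈ conjugatesOf r | Hecke.IsReciprocator (Hecke.iota p) g} := by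
        rw [← Hecke.setOf_isPReciprocal hp hm hyp hr, ← hA']
        ext g
        constructor
        · exact fun ⟨h1, h2, h3⟩ => ⟨⟨h1, h2⟩, fun h => h3 h.2⟩
        · exact fun ⟨⟨h1, h2⟩, h3⟩ => ⟨h1, h2, fun h => h3 ⟨h1, h⟩⟩
      have hAB : {g ∈ conjugatesOf r | Hecke.IsReciprocator (Hecke.iota p) g} ⊆
          {g ∈ conjugatesOf r | Hecke.IsReciprocator (Hecke.gam p ^ m) g} :=
        fun g hg => ⟨hg.1, hsub g hg.1 hg.2⟩
      rw [hdiff, Set.encard_sdiff hAB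
        (Set.finite_of_encard_eq_coe (k := 2) (by rw [hA]; rfl)), hA, hB]
      rfl
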